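/- Let $T\subset\mathbb{R}^2$ be a (non-degenerate) triangle with vertices $p_0,p_1,p_2$. A finite set $Y\subset T$ is called a convex chain (from $p_0$ to $p_2$) if the convex hull of $Y\cup\{p_0,p_2\}$ has exactly $|Y|+2$ vertices; its length is $|Y|$. Let $X_n$ be a sample of $n$ independent points, each uniformly distributed in $T$ (with respect to normalized Lebesgue measure), and let $L_n$ be the largest length of a convex chain $Y\subseteq X_n$. Then there is a constant $\alpha>0$, the same for all triangles $T$, such that $$\lim_{n\to\infty}\frac{\mathbb{E}L_n}{\sqrt[3]{n}}=\alpha .$$ Moreover $\limsup_{n\to\infty} n^{-1/3}\,\mathbb{E}L_n\le\sqrt[3]{2}\,e$ and $\liminf_{n\to\infty} n^{-1/3}\,\mathbb{E}L_n\ge(1-e^{-2})/\sqrt[3]{2}\approx 0.6863$; that is, $$\frac{1-e^{-2}}{\sqrt[3]{2}}\le\alpha\le\sqrt[3]{2}\,e .$$ -/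

import Mathlib

open MeasureTheory ProbabilityTheory Filter Topology

/-- The Euclidean plane. -/
abbrev Plane : Type := EuclideanSpace ℝ (Fin 2)

/-- The (closed, filled) triangle with vertices `p₀, p₁, p₂`. -/
def triangle (p₀ p₁ p₂ : Plane) : Set Plane := convexHull ℝ {p₀, p₁, p₂}

/-- The uniform distribution on the triangle: normalized Lebesgue measure. -/
noncomputable def uniformTriangle (p₀ p₁ p₂ : Plane) : Measure Plane :=
  ProbabilityTheory.cond volume (triangle p₀ p₁ p₂)

/-- The law of `n` independent uniform points in the triangle. -/
noncomputable def sampleLaw (p₀ p₁ p₂ : Plane) (n : ℕ) : Measure (Fin n → Plane) :=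
  Measure.pi fun _ => uniformTriangle p₀ p₁ p₂

/-- A finite set `Y` is a convex chain from `p₀` to `p₂` in the triangle if it lies in the
triangle and the convex hull of `Y ∪ {p₀, p₂}` has exactly `|Y| + 2` vertices. -/
def IsConvexChain (p₀ p₁ p₂ : Plane) (Y : Finset Plane) : Prop :=
  (Y : Set Plane) ⊆ triangle p₀ p₁ p₂ ∧
    ((convexHull ℝ ((Y : Set Plane) ∪ {p₀, p₂})).extremePoints ℝ).ncard = Y.card + 2

open Classical in
/-- The largest number of points of a convex chain contained in the finite set `X`. -/
noncomputable def longestChain (p₀ p₁ p₂ : Plane) (X : Finset Plane) : ℕ :=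
  (X.powerset.filter fun Y => IsConvexChain p₀ p₁ p₂ Y).sup Finset.card

open Classical in
/-- The random variable `L_n`, as a function of the sample `x₁, …, xₙ`. -/
noncomputable def chainLength (p₀ p₁ p₂ : Plane) (n : ℕ) (x : Fin n → Plane) : ℝ :=
  (longestChain p₀ p₁ p₂ (Finset.univ.image x) : ℝ)

/-!
The expected length `a n = E L_n` of the longest convex chain is the same for all triangles, since
an affine map between two triangles transports the uniform law and the convex chains. So it may be
studied in the triangle with vertices `(0, 0)`, `(1, 0)`, `(1, 1)`, where it is called `stdMean`.

*Superadditivity.* Consider the parabola that touches two sides of the triangle at `p₀` and `p₂`. A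
tangent of it cuts off two triangles, at `p₀` and at `p₂`, of relative areas `t ^ 3` and
`(1 - t) ^ 3`, and chains in them concatenate to a chain of the big triangle
(`IsChainFamily.sumElim`). The sample points in a subtriangle are a binomial number of independent
uniform points (`meanLength_eq_binomMean`), hence
`E a (Bin (n, t ^ 3)) + E a (Bin (n, (1 - t) ^ 3)) ≤ a n` (`stdMean_superadditive`). With a Poisson
number of points in place of `n`, thinning turns this into superadditivity of
`g s = E a (Poisson (s ^ 3))` (`poissonMean_cube_superadditive`), so that `g s / s` tends to its
supremum `α` (`exists_slope_of_superadditive`). As `a` is monotone and a Poisson variable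
concentrates around its mean, `a n / n ^ (1 / 3)` has the same limit.

*Lower bound.* With `s ^ 3 = 2` the sample is nonempty with probability `1 - exp (-2)`, and one
point is almost surely a chain; so `α ≥ g s / s ≥ (1 - exp (-2)) / 2 ^ (1 / 3)`.

*Upper bound.* The increments of the coordinates along a chain of `k` points are positive vectors
`a`, `b` with sums at most `1` and increasing slopes `b i / a i`. The increments of each coordinate
range over a simplex of volume `1 / k!`, and only one of the `k!` joint permutations of `a` and `b`
has increasing slopes, so ordered chains have volume at most `1 / k! ^ 3`
(`factorial_pow_mul_volume_orderedChains_le`). The union bound over `k`-tuples gives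
`P (L_n ≥ k) ≤ (2 n) ^ k / k! ^ 3`, which decays geometrically once `k` exceeds
`(2 ^ (1 / 3) e + ε) n ^ (1 / 3)`.
-/

/-! ### Poisson averages of a sequence -/

/-- The mean `E a_N` for `N` a Poisson variable of parameter `r`. -/
noncomputable def poissonMean (a : ℕ → ℝ) (r : ℝ) : ℝ :=
  Real.exp (-r) * ∑' k : ℕ, r ^ k / (k.factorial : ℝ) * a k

/-- The mean `E a_N` for `N` a binomial variable of parameters `n` and `p`. -/
noncomputable def binomMean (a : ℕ → ℝ) (n : ℕ) (p : ℝ) : ℝ :=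
  ∑ k ∈ Finset.range (n + 1), (n.choose k : ℝ) * p ^ k * (1 - p) ^ (n - k) * a k

lemma hasSum_exp_series (r : ℝ) :
    HasSum (fun k : ℕ => r ^ k / (k.factorial : ℝ)) (Real.exp r) := by
  rw [Real.exp_eq_exp_ℝ]
  exact NormedSpace.expSeries_div_hasSum_exp r

lemma hasSum_exp_series_mul_id (r : ℝ) :
    HasSum (fun k : ℕ => r ^ k / (k.factorial : ℝ) * k) (r * Real.exp r) := by
  rw [← hasSum_nat_add_iff' 1]
  simp only [Finset.sum_range_one, CharP.cast_eq_zero, mul_zero, sub_zero]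
  refine Eq.mpr (congrArg (fun f => HasSum f _) (funext fun k => ?_)) ((hasSum_exp_series r).mul_left r)
  rw [Nat.factorial_succ]
  push_cast
  have : (k.factorial : ℝ) ≠ 0 := by positivity
  field_simp
  ring

lemma hasSum_exp_series_mul_sq (r : ℝ) :
    HasSum (fun k : ℕ => r ^ k / (k.factorial : ℝ) * (k : ℝ) ^ 2) ((r ^ 2 + r) * Real.exp r) := by
  rw [← hasSum_nat_add_iff' 1]
  simp only [Finset.sum_range_one, CharP.cast_eq_zero, ne_eq, OfNat.ofNat_ne_zero,
    not_false_eq_true, zero_pow, mul_zero, sub_zero]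
  have h := ((hasSum_exp_series_mul_id r).add (hasSum_exp_series r)).mul_left r
  rw [show r * (r * Real.exp r + Real.exp r) = (r ^ 2 + r) * Real.exp r by ring] at h
  refine Eq.mpr (congrArg (fun f => HasSum f _) (funext fun k => ?_)) h
  rw [Nat.factorial_succ]
  push_cast
  have : (k.factorial : ℝ) ≠ 0 := by positivity
  field_simp
  ring

section

variable {a : ℕ → ℝ}

lemma summable_poisson (h0 : ∀ k, 0 ≤ a k) (h1 : ∀ k : ℕ, a k ≤ k) {r : ℝ} (hr : 0 ≤ r) :
    Summable (fun k : ℕ => r ^ k / (k.factorial : ℝ) * a k) := by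
  refine Summable.of_nonneg_of_le (fun k => ?_) (fun k => ?_) (hasSum_exp_series_mul_id r).summable
  · have := h0 k
    positivity
  · gcongr
    exact h1 k

lemma poissonMean_nonneg (h0 : ∀ k, 0 ≤ a k) {r : ℝ} (hr : 0 ≤ r) : 0 ≤ poissonMean a r := by
  refine mul_nonneg (Real.exp_pos _).le (tsum_nonneg fun k => ?_)
  have := h0 k
  positivity

/-- A pointwise bound of `a` by a polynomial of degree two bounds its Poisson mean by the mean of
the polynomial. -/
lemma poissonMean_le_of_le (h0 : ∀ k, 0 ≤ a k) (h1 : ∀ k : ℕ, a k ≤ k) {r A B C : ℝ} (hr : 0 ≤ r)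
    (h : ∀ k : ℕ, a k ≤ A + B * k + C * (k : ℝ) ^ 2) :
    poissonMean a r ≤ A + B * r + C * (r ^ 2 + r) := by
  have hs := ((hasSum_exp_series r).mul_left A).add
    (((hasSum_exp_series_mul_id r).mul_left B).add ((hasSum_exp_series_mul_sq r).mul_left C))
  have := (summable_poisson h0 h1 hr).tsum_le_tsum (g := fun k : ℕ => A * (r ^ k / (k.factorial : ℝ))
    + (B * (r ^ k / (k.factorial : ℝ) * k) + C * (r ^ k / (k.factorial : ℝ) * (k : ℝ) ^ 2)))
    (fun k => ?_) hs.summable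
  · rw [hs.tsum_eq] at this
    calc poissonMean a r ≤ Real.exp (-r) * (A * Real.exp r + (B * (r * Real.exp r)
          + C * ((r ^ 2 + r) * Real.exp r))) := by
          unfold poissonMean
          gcongr
      _ = (Real.exp (-r) * Real.exp r) * (A + B * r + C * (r ^ 2 + r)) := by ring
      _ = _ := by rw [← Real.exp_add]; simp
  · have hk : 0 ≤ r ^ k / (k.factorial : ℝ) := by positivity
    nlinarith [mul_le_mul_of_nonneg_left (h k) hk]

lemma le_poissonMean_of_le (h0 : ∀ k, 0 ≤ a k) (h1 : ∀ k : ℕ, a k ≤ k) {r A B C : ℝ} (hr : 0 ≤ r)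
    (h : ∀ k : ℕ, A + B * k + C * (k : ℝ) ^ 2 ≤ a k) :
    A + B * r + C * (r ^ 2 + r) ≤ poissonMean a r := by
  have hs := ((hasSum_exp_series r).mul_left A).add
    (((hasSum_exp_series_mul_id r).mul_left B).add ((hasSum_exp_series_mul_sq r).mul_left C))
  have := hs.summable.tsum_le_tsum (f := fun k : ℕ => A * (r ^ k / (k.factorial : ℝ))
    + (B * (r ^ k / (k.factorial : ℝ) * k) + C * (r ^ k / (k.factorial : ℝ) * (k : ℝ) ^ 2)))
    (fun k => ?_) (summable_poisson h0 h1 hr)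
  · rw [hs.tsum_eq] at this
    calc _ = (Real.exp (-r) * Real.exp r) * (A + B * r + C * (r ^ 2 + r)) := by
          rw [← Real.exp_add]; simp
      _ = Real.exp (-r) * (A * Real.exp r + (B * (r * Real.exp r)
          + C * ((r ^ 2 + r) * Real.exp r))) := by ring
      _ ≤ poissonMean a r := by
          unfold poissonMean
          gcongr
  · have hk : 0 ≤ r ^ k / (k.factorial : ℝ) := by positivity
    nlinarith [mul_le_mul_of_nonneg_left (h k) hk]

/-- Poisson thinning: keeping each of a Poisson number of points with probability `p` leaves a
Poisson number of points. It is the Cauchy product of the series of `poissonMean a (r * p)` and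
of `exp (r * (1 - p))`. -/
lemma hasSum_binomMean (h0 : ∀ k, 0 ≤ a k) (h1 : ∀ k : ℕ, a k ≤ k) {r p : ℝ} (hr : 0 ≤ r)
    (hp : 0 ≤ p) :
    HasSum (fun n : ℕ => r ^ n / (n.factorial : ℝ) * binomMean a n p)
      (Real.exp r * poissonMean a (r * p)) := by
  have hs := summable_poisson h0 h1 (mul_nonneg hr hp)
  have h := hasSum_sum_range_mul_of_summable_norm hs.norm (hasSum_exp_series (r * (1 - p))).summable.norm
  rw [(hasSum_exp_series _).tsum_eq] at h
  have e : (∑' k : ℕ, (r * p) ^ k / (k.factorial : ℝ) * a k) * Real.exp (r * (1 - p))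
      = Real.exp r * poissonMean a (r * p) := by
    unfold poissonMean
    rw [← mul_assoc, ← Real.exp_add, mul_comm]
    ring_nf
  rw [e] at h
  refine Eq.mpr (congrArg (fun f => HasSum f _) (funext fun n => ?_)) h
  unfold binomMean
  rw [Finset.mul_sum]
  refine Finset.sum_congr rfl fun k hk => ?_
  have hkn : k ≤ n := by simpa [Nat.lt_succ_iff] using hk
  rw [Nat.cast_choose ℝ hkn, mul_pow, mul_pow, ← pow_mul_pow_sub r hkn]
  have h1 : (n.factorial : ℝ) ≠ 0 := by positivity
  have h2 : (k.factorial : ℝ) ≠ 0 := by positivity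
  have h3 : ((n - k).factorial : ℝ) ≠ 0 := by positivity
  field_simp

/-- Binomial superadditivity of `a` turns into superadditivity of `s ↦ poissonMean a (s ^ 3)`. -/
lemma poissonMean_cube_superadditive (h0 : ∀ k, 0 ≤ a k) (h1 : ∀ k : ℕ, a k ≤ k)
    (hsup : ∀ n : ℕ, ∀ t : ℝ, 0 < t → t < 1 →
      binomMean a n (t ^ 3) + binomMean a n ((1 - t) ^ 3) ≤ a n)
    {s u : ℝ} (hs : 0 < s) (hu : 0 < u) :
    poissonMean a (s ^ 3) + poissonMean a (u ^ 3) ≤ poissonMean a ((s + u) ^ 3) := by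
  set t := s / (s + u) with ht
  have hsu : 0 < s + u := by positivity
  have ht0 : 0 < t := by positivity
  have ht1 : t < 1 := by rw [ht, div_lt_one hsu]; linarith
  have e1 : (s + u) ^ 3 * t ^ 3 = s ^ 3 := by rw [ht]; field_simp
  have e2 : (s + u) ^ 3 * (1 - t) ^ 3 = u ^ 3 := by rw [ht]; field_simp; ring
  have hr : 0 ≤ (s + u) ^ 3 := by positivity
  have A := hasSum_binomMean h0 h1 hr (p := t ^ 3) (by positivity)
  have B := hasSum_binomMean h0 h1 hr (p := (1 - t) ^ 3) (pow_nonneg (by linarith) 3)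
  have hle := hasSum_le (fun n => ?_) (A.add B) (summable_poisson h0 h1 hr).hasSum
  · rw [e1, e2] at hle
    have := mul_le_mul_of_nonneg_left hle (Real.exp_pos (-(s + u) ^ 3)).le
    rw [← mul_add, ← mul_assoc, ← Real.exp_add] at this
    simpa [poissonMean] using this
  · rw [← mul_add]
    gcongr
    exact hsup n t ht0 ht1

end

/-! ### Superadditive functions and depoissonization -/

/-- Fekete's lemma for a nonnegative superadditive function on the half-line. -/
lemma exists_slope_of_superadditive {g : ℝ → ℝ} {c : ℝ} (g0 : ∀ s, 0 < s → 0 ≤ g s)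
    (hg : ∀ s u, 0 < s → 0 < u → g s + g u ≤ g (s + u))
    (hB : ∀ ε, 0 < ε → ∃ K, ∀ s, 0 < s → g s ≤ (c + ε) * s + K) :
    ∃ α, α ≤ c ∧ (∀ s, 0 < s → g s ≤ α * s) ∧
      ∀ ε, 0 < ε → ∃ S, ∀ s, S ≤ s → 0 < s → (α - ε) * s ≤ g s := by
  have hmul : ∀ s, 0 < s → ∀ m : ℕ, (m + 1 : ℝ) * g s ≤ g ((m + 1 : ℝ) * s) := by
    intro s hs m
    induction m with
    | zero => simp
    | succ m ih =>
      have := hg ((m + 1 : ℝ) * s) s (by positivity) hs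
      push_cast
      have e : (m + 1 + 1 : ℝ) * s = (m + 1 : ℝ) * s + s := by ring
      rw [e]
      linarith
  have hmono : ∀ s u, 0 < s → s ≤ u → g s ≤ g u := by
    intro s u hs hsu
    rcases hsu.eq_or_lt with rfl | h
    · rfl
    · have := hg s (u - s) hs (by linarith)
      have := g0 (u - s) (by linarith)
      rw [add_sub_cancel] at *
      linarith
  have hbd : ∀ s, 0 < s → g s / s ≤ c := by
    intro s hs
    refine le_of_forall_pos_le_add fun ε hε => ?_
    obtain ⟨K, hK⟩ := hB ε hε
    have hlim : Tendsto (fun m : ℕ => (c + ε) + K / s * (1 / ((m : ℝ) + 1))) atTop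
        (𝓝 ((c + ε) + K / s * 0)) :=
      (tendsto_one_div_add_atTop_nhds_zero_nat.const_mul _).const_add _
    rw [mul_zero, add_zero] at hlim
    refine ge_of_tendsto' hlim fun m => ?_
    have h1 := hmul s hs m
    have h2 := hK ((m + 1 : ℝ) * s) (by positivity)
    rw [div_le_iff₀ hs]
    have hm : (0 : ℝ) < m + 1 := by positivity
    have : ((c + ε) + K / s * (1 / ((m : ℝ) + 1))) * s
      = ((c + ε) * ((m + 1 : ℝ) * s) + K) / (m + 1) := by field_simp
    rw [this, le_div_iff₀ hm]
    linarith
  set A : Set ℝ := (fun s => g s / s) '' Set.Ioi 0 with hA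
  have hAne : A.Nonempty := ⟨_, 1, by simp, rfl⟩
  have hAb : BddAbove A := ⟨c, by rintro _ ⟨s, hs, rfl⟩; exact hbd s hs⟩
  refine ⟨sSup A, csSup_le hAne (by rintro _ ⟨s, hs, rfl⟩; exact hbd s hs), ?_, ?_⟩
  · intro s hs
    rw [← div_le_iff₀ hs]
    exact le_csSup hAb ⟨s, hs, rfl⟩
  · intro ε hε
    obtain ⟨_, ⟨s₀, hs₀, rfl⟩, h⟩ := exists_lt_of_lt_csSup hAne (show sSup A - ε / 2 < sSup A by linarith)
    rw [Set.mem_Ioi] at hs₀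
    refine ⟨max s₀ (2 * g s₀ / ε), fun s hs hs' => ?_⟩
    have h1 : s₀ ≤ s := (le_max_left _ _).trans hs
    have h2 : 2 * g s₀ / ε ≤ s := (le_max_right _ _).trans hs
    rw [div_le_iff₀ hε] at h2
    have hfl : 1 ≤ ⌊s / s₀⌋₊ := Nat.one_le_floor_iff _ |>.2 ((one_le_div hs₀).2 h1)
    obtain ⟨m, hm⟩ := Nat.exists_eq_add_of_le' hfl
    have h3 := hmul s₀ hs₀ m
    have hf1 : ((m : ℝ) + 1) ≤ s / s₀ := by
      have := Nat.floor_le (show 0 ≤ s / s₀ by positivity)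
      rw [hm] at this; push_cast at this; exact this
    have hf2 : s / s₀ < (m : ℝ) + 1 + 1 := by
      have := Nat.lt_floor_add_one (s / s₀)
      rw [hm] at this; push_cast at this; exact this
    have h4 := hmono ((m + 1 : ℝ) * s₀) s (by positivity) ((le_div_iff₀ hs₀).1 hf1)
    have h5 : (s / s₀ - 1) * g s₀ ≤ (m + 1 : ℝ) * g s₀ :=
      mul_le_mul_of_nonneg_right (by linarith) (g0 _ hs₀)
    have h6 : (sSup A - ε / 2) * s ≤ g s₀ / s₀ * s := mul_le_mul_of_nonneg_right h.le hs'.le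
    have h7 : (s / s₀ - 1) * g s₀ = g s₀ / s₀ * s - g s₀ := by field_simp
    linarith

lemma rpow_third_cube {x : ℝ} (hx : 0 ≤ x) : (x ^ (1 / 3 : ℝ)) ^ 3 = x := by
  rw [← Real.rpow_natCast, ← Real.rpow_mul hx]; norm_num

/-- The first moment bound, optimized over `k`: take `k` just above `(2 ^ (1 / 3) e + ε) n ^ (1 / 3)`
and use `k! ≥ (k / e) ^ k`. -/
lemma le_cube_root_of_moment_bound {a : ℕ → ℝ}
    (hu : ∀ n k : ℕ, a n ≤ k + n * ((2 * n : ℝ) ^ k / (k.factorial : ℝ) ^ 3)) {ε : ℝ} (hε : 0 < ε) :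
    ∃ K, 0 ≤ K ∧ ∀ n : ℕ, a n ≤ ((2 : ℝ) ^ (1 / 3 : ℝ) * Real.exp 1 + ε) * (n : ℝ) ^ (1 / 3 : ℝ) + K := by
  set c : ℝ := (2 : ℝ) ^ (1 / 3 : ℝ) * Real.exp 1 with hc
  have hc3 : c ^ 3 = 2 * Real.exp 1 ^ 3 := by
    rw [hc, mul_pow, rpow_third_cube (by norm_num)]
  have hc0 : 0 < c := by positivity
  have hc1 : 1 ≤ c ^ 3 := by
    have : 1 ≤ Real.exp 1 := Real.one_le_exp (by norm_num)
    have := one_le_pow₀ this (n := 3)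
    linarith
  set ρ : ℝ := (c / (c + ε)) ^ 3 with hρ
  have hρ0 : 0 ≤ ρ := by positivity
  have hρ1 : ρ < 1 := by
    refine pow_lt_one₀ (by positivity) ?_ (by norm_num)
    rw [div_lt_one (by positivity)]; linarith
  obtain ⟨M, hM⟩ := (tendsto_pow_const_mul_const_pow_of_lt_one 3 hρ0 hρ1).bddAbove_range
  have hM' : ∀ k : ℕ, (k : ℝ) ^ 3 * ρ ^ k ≤ M := fun k => hM ⟨k, rfl⟩
  have hM0 : 0 ≤ M := by simpa using hM' 0
  refine ⟨M + 1, by linarith, fun n => ?_⟩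
  rcases Nat.eq_zero_or_pos n with rfl | hn
  · have := hu 0 0
    simp at this ⊢
    linarith
  set s : ℝ := (n : ℝ) ^ (1 / 3 : ℝ) with hs
  have hn0 : (0 : ℝ) < n := by exact_mod_cast hn
  have hs0 : 0 < s := by positivity
  have hs3 : s ^ 3 = n := rpow_third_cube hn0.le
  set k := ⌈(c + ε) * s⌉₊ with hk
  have hk1 : (c + ε) * s ≤ k := Nat.le_ceil _
  have hk2 : (k : ℝ) < (c + ε) * s + 1 := Nat.ceil_lt_add_one (by positivity)
  have hk0 : (0 : ℝ) < k := lt_of_lt_of_le (by positivity) hk1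
  have hcs : c * s ≤ k := le_trans (by gcongr; linarith) hk1
  have hfac : (k : ℝ) ^ k ≤ Real.exp 1 ^ k * k.factorial := by
    have := Real.pow_div_factorial_le_exp (x := k) hk0.le k
    rw [div_le_iff₀ (by positivity)] at this
    rwa [← Real.exp_nat_mul, mul_one]
  have hnk : (n : ℝ) ≤ (k : ℝ) ^ 3 := by
    rw [← hs3]
    calc s ^ 3 ≤ c ^ 3 * s ^ 3 := le_mul_of_one_le_left (by positivity) hc1
      _ = (c * s) ^ 3 := by ring
      _ ≤ _ := by gcongr
  have hmain : (2 * n : ℝ) ^ k / (k.factorial : ℝ) ^ 3 ≤ ρ ^ k := by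
    rw [div_le_iff₀ (by positivity)]
    have h1 : ((k : ℝ) ^ k) ^ 3 ≤ (Real.exp 1 ^ k * k.factorial) ^ 3 := by gcongr
    have h2 : (2 * n : ℝ) * Real.exp 1 ^ 3 ≤ ρ * (k : ℝ) ^ 3 := by
      have e : (2 * n : ℝ) * Real.exp 1 ^ 3 = (c / (c + ε)) ^ 3 * ((c + ε) * s) ^ 3 := by
        have : (c / (c + ε)) ^ 3 * ((c + ε) * s) ^ 3 = c ^ 3 * s ^ 3 := by field_simp
        rw [this, hc3, hs3]; ring
      rw [e]
      gcongr
    have h3 : ((2 * n : ℝ) * Real.exp 1 ^ 3) ^ k ≤ (ρ * (k : ℝ) ^ 3) ^ k := by gcongr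
    have he : 0 < (Real.exp 1 ^ 3) ^ k := by positivity
    refine le_of_mul_le_mul_right ?_ he
    calc (2 * n : ℝ) ^ k * (Real.exp 1 ^ 3) ^ k = ((2 * n : ℝ) * Real.exp 1 ^ 3) ^ k := by
          rw [mul_pow _ (Real.exp 1 ^ 3)]
      _ ≤ (ρ * (k : ℝ) ^ 3) ^ k := h3
      _ = ρ ^ k * ((k : ℝ) ^ k) ^ 3 := by rw [mul_pow]; ring
      _ ≤ ρ ^ k * (Real.exp 1 ^ k * k.factorial) ^ 3 := by gcongr
      _ = _ := by ring
  calc a n ≤ k + n * ((2 * n : ℝ) ^ k / (k.factorial : ℝ) ^ 3) := hu n k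
    _ ≤ k + (k : ℝ) ^ 3 * ρ ^ k := by gcongr
    _ ≤ (c + ε) * s + (M + 1) := by linarith [hM' k]

/-- Depoissonization from below: at a Poisson parameter `r` slightly smaller than `n`, the terms
with `k ≤ n` are at most `a n` by monotonicity, the others at most a multiple of `(k - r) ^ 2`,
whose Poisson mean is `r`. -/
lemma poissonMean_le_add {a : ℕ → ℝ} (h0 : ∀ k, 0 ≤ a k) (h1 : ∀ k : ℕ, a k ≤ k) (hm : Monotone a)
    {n : ℕ} (hn : 0 < n) {r ε : ℝ} (hε : 0 < ε) (hr : 0 ≤ r) (hrn : r ≤ (1 - ε) * n) :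
    poissonMean a r ≤ a n + 1 / ε ^ 2 := by
  have hn0 : (0 : ℝ) < n := by exact_mod_cast hn
  set d : ℝ := 1 / (ε ^ 2 * n) with hd
  have hd0 : 0 < d := by positivity
  have := poissonMean_le_of_le h0 h1 (A := a n + d * r ^ 2) (B := - (2 * d * r)) (C := d) hr
    (fun k => ?_)
  · have h2 : d * r ≤ 1 / ε ^ 2 := by
      rw [hd, div_mul_eq_mul_div, one_mul, div_le_div_iff₀ (by positivity) (by positivity)]
      have : r ≤ n := hrn.trans (by nlinarith)
      have := mul_le_mul_of_nonneg_right this (sq_nonneg ε)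
      linarith
    nlinarith
  · have e : a n + d * r ^ 2 + -(2 * d * r) * k + d * (k : ℝ) ^ 2 = a n + d * (k - r) ^ 2 := by ring
    rw [e]
    rcases le_total k n with hk | hk
    · have := hm hk
      nlinarith [mul_nonneg hd0.le (sq_nonneg (k - r))]
    · have hk' : (n : ℝ) ≤ k := by exact_mod_cast hk
      have h3 : ε * k ≤ k - r := by nlinarith
      have h4 : (ε * k) ^ 2 ≤ (k - r) ^ 2 := pow_le_pow_left₀ (by positivity) h3 2
      have h5 : (k : ℝ) ≤ d * (k - r) ^ 2 := by
        rw [hd, div_mul_eq_mul_div, one_mul, le_div_iff₀ (by positivity)]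
        have h6 : (k : ℝ) * n ≤ k * k := by gcongr
        nlinarith [mul_le_mul_of_nonneg_left h6 (sq_nonneg ε)]
      linarith [h1 k, h0 n]

/-- Depoissonization from above, at a Poisson parameter `r` slightly larger than `n`: again by a
Chebyshev-type comparison of `a k` with a multiple of `(k - r) ^ 2`. -/
lemma mul_le_poissonMean {a : ℕ → ℝ} (h0 : ∀ k, 0 ≤ a k) (h1 : ∀ k : ℕ, a k ≤ k) (hm : Monotone a)
    {n : ℕ} (hn : 0 < n) {r ε : ℝ} (hε : 0 < ε) (hrn : (1 + ε) * n ≤ r) :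
    a n * (1 - r / (ε * n) ^ 2) ≤ poissonMean a r := by
  have hn0 : (0 : ℝ) < n := by exact_mod_cast hn
  have hr : 0 ≤ r := le_trans (by positivity) hrn
  set d : ℝ := 1 / (ε * n) ^ 2 with hd
  have hd0 : 0 < d := by positivity
  have := le_poissonMean_of_le h0 h1 (A := a n * (1 - d * r ^ 2)) (B := a n * (2 * d * r))
    (C := - (a n * d)) hr (fun k => ?_)
  · refine le_trans (le_of_eq ?_) this
    rw [div_eq_mul_one_div, ← hd]; ring
  · have e : a n * (1 - d * r ^ 2) + a n * (2 * d * r) * k + -(a n * d) * (k : ℝ) ^ 2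
        = a n * (1 - d * (k - r) ^ 2) := by ring
    rw [e]
    rcases le_total n k with hk | hk
    · have := hm hk
      nlinarith [mul_nonneg (h0 n) (mul_nonneg hd0.le (sq_nonneg (k - r)))]
    · have hk' : (k : ℝ) ≤ n := by exact_mod_cast hk
      have h3 : ε * n ≤ r - k := by nlinarith
      have h4 : (ε * n) ^ 2 ≤ (r - k) ^ 2 := pow_le_pow_left₀ (by positivity) h3 2
      have h5 : 1 ≤ d * (k - r) ^ 2 := by
        rw [hd, div_mul_eq_mul_div, one_mul, le_div_iff₀ (by positivity)]
        nlinarith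
      exact (mul_nonpos_of_nonneg_of_nonpos (h0 n) (by linarith)).trans (h0 k)

/-- The limit theorem for an abstract sequence with the properties of `E L_n`. -/
theorem exists_limit_of_binomial_superadditive {a : ℕ → ℝ} (h0 : ∀ k, 0 ≤ a k)
    (h1 : ∀ k : ℕ, a k ≤ k) (hm : Monotone a) (hone : 1 ≤ a 1)
    (hsup : ∀ n : ℕ, ∀ t : ℝ, 0 < t → t < 1 →
      binomMean a n (t ^ 3) + binomMean a n ((1 - t) ^ 3) ≤ a n)
    (hu : ∀ n k : ℕ, a n ≤ k + n * ((2 * n : ℝ) ^ k / (k.factorial : ℝ) ^ 3)) :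
    ∃ α : ℝ, 0 < α ∧ (1 - Real.exp (-2)) / (2 : ℝ) ^ (1 / 3 : ℝ) ≤ α ∧
      α ≤ (2 : ℝ) ^ (1 / 3 : ℝ) * Real.exp 1 ∧
      Tendsto (fun n : ℕ => a n / (n : ℝ) ^ (1 / 3 : ℝ)) atTop (𝓝 α) := by
  obtain ⟨α, hαc, hα1, hα2⟩ := exists_slope_of_superadditive
    (g := fun s => poissonMean a (s ^ 3)) (c := (2 : ℝ) ^ (1 / 3 : ℝ) * Real.exp 1)
    (fun s hs => poissonMean_nonneg h0 (by positivity))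
    (fun s u hs hu => poissonMean_cube_superadditive h0 h1 hsup hs hu) (by
      intro ε hε
      obtain ⟨K, hK0, hK⟩ := le_cube_root_of_moment_bound hu hε
      refine ⟨K, fun s hs => ?_⟩
      set C := (2 : ℝ) ^ (1 / 3 : ℝ) * Real.exp 1 + ε
      have hC : 0 < C := by positivity
      -- the tangent line of the cube root at `s ^ 3` lies above it
      have htan : ∀ k : ℕ, (k : ℝ) ^ (1 / 3 : ℝ) ≤ 2 / 3 * s + 1 / (3 * s ^ 2) * k := by
        intro k
        set u := (k : ℝ) ^ (1 / 3 : ℝ)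
        have hu0 : 0 ≤ u := by positivity
        have hu3 : u ^ 3 = k := rpow_third_cube (Nat.cast_nonneg k)
        rw [← hu3]
        have e : 2 / 3 * s + 1 / (3 * s ^ 2) * u ^ 3 - u = (u - s) ^ 2 * (u + 2 * s) / (3 * s ^ 2) := by
          field_simp; ring
        have : 0 ≤ (u - s) ^ 2 * (u + 2 * s) / (3 * s ^ 2) := by positivity
        linarith
      refine (poissonMean_le_of_le h0 h1 (A := C * (2 / 3 * s) + K) (B := C * (1 / (3 * s ^ 2)))
        (C := 0) (by positivity) (fun k => ?_)).trans (le_of_eq ?_)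
      · nlinarith [hK k, mul_le_mul_of_nonneg_left (htan k) hC.le]
      · field_simp; ring)
  -- at parameter `2` the sample is nonempty with probability `1 - exp (-2)`
  have hlow : (1 - Real.exp (-2)) / (2 : ℝ) ^ (1 / 3 : ℝ) ≤ α := by
    have h := hα1 ((2 : ℝ) ^ (1 / 3 : ℝ)) (by positivity)
    rw [rpow_third_cube (by norm_num)] at h
    rw [div_le_iff₀ (by positivity)]
    refine le_trans ?_ h
    have hs : ∑' k : ℕ, (2 : ℝ) ^ k / (k.factorial : ℝ) * a k ≥ Real.exp 2 - 1 := by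
      have hE := hasSum_exp_series 2
      rw [← hasSum_nat_add_iff' 1] at hE
      have hS := summable_poisson h0 h1 (r := 2) (by norm_num)
      rw [hS.tsum_eq_zero_add]
      have := hE.summable.tsum_le_tsum (fun k => ?_) ((summable_nat_add_iff 1).2 hS)
      · rw [hE.tsum_eq] at this
        simp at this ⊢
        linarith [h0 0]
      · exact le_mul_of_one_le_right (by positivity) (hone.trans (hm (by lia)))
    unfold poissonMean
    calc 1 - Real.exp (-2) = Real.exp (-2) * (Real.exp 2 - 1) := by
          rw [mul_sub, ← Real.exp_add]; simp
      _ ≤ _ := by gcongr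
  have hαpos : 0 < α := by
    refine lt_of_lt_of_le (div_pos ?_ (by positivity)) hlow
    have : Real.exp (-2) < 1 := by simp
    linarith
  refine ⟨α, hαpos, hlow, hαc, ?_⟩
  have hsinf : Tendsto (fun n : ℕ => (n : ℝ) ^ (1 / 3 : ℝ)) atTop atTop :=
    (tendsto_rpow_atTop (by norm_num)).comp tendsto_natCast_atTop_atTop
  rw [tendsto_order]
  constructor
  · intro b hb
    have hlim : Tendsto (fun ε : ℝ => (α - ε) * (1 - ε) - ε) (𝓝[>] 0) (𝓝 α) := by
      have : Tendsto (fun ε : ℝ => (α - ε) * (1 - ε) - ε) (𝓝 0) (𝓝 ((α - 0) * (1 - 0) - 0)) :=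
        (Continuous.tendsto (by fun_prop) 0)
      simp only [sub_zero, mul_one] at this
      exact this.mono_left nhdsWithin_le_nhds
    obtain ⟨ε, hbε, hε0, hε1⟩ := ((hlim.eventually (lt_mem_nhds hb)).and
      (Ioo_mem_nhdsGT (show (0 : ℝ) < 1 by norm_num))).exists
    obtain ⟨S, hS⟩ := hα2 ε hε0
    filter_upwards [hsinf.eventually_ge_atTop (S / (1 - ε)), hsinf.eventually_ge_atTop (1 / ε ^ 3),
      eventually_gt_atTop 0] with n hn1 hn2 hn
    have hn0 : (0 : ℝ) < n := by exact_mod_cast hn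
    set s := (n : ℝ) ^ (1 / 3 : ℝ) with hs
    have hs0 : 0 < s := by positivity
    have hs3 : s ^ 3 = n := rpow_third_cube hn0.le
    have h1ε : 0 < 1 - ε := by linarith
    rw [div_le_iff₀ h1ε] at hn1
    rw [div_le_iff₀ (by positivity)] at hn2
    have k1 := hS ((1 - ε) * s) (by linarith) (by positivity)
    have k2 := poissonMean_le_add h0 h1 hm hn (r := ((1 - ε) * s) ^ 3) hε0 (by positivity) (by
      rw [mul_pow, hs3]
      gcongr
      exact pow_le_of_le_one h1ε.le (by linarith) (by norm_num))
    refine lt_of_lt_of_le hbε ?_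
    rw [le_div_iff₀ hs0]
    have : 1 / ε ^ 2 ≤ ε * s := by
      rw [div_le_iff₀ (by positivity)]; linarith
    linarith
  · intro b hb
    have hlim : Tendsto (fun ε : ℝ => α * (1 + ε) / (1 - ε)) (𝓝[>] 0) (𝓝 α) := by
      have : Tendsto (fun ε : ℝ => α * (1 + ε) / (1 - ε)) (𝓝 0) (𝓝 (α * (1 + 0) / (1 - 0))) :=
        ContinuousAt.tendsto (by
          refine ContinuousAt.div (by fun_prop) (by fun_prop) (by norm_num))
      simp only [sub_zero, add_zero, mul_one, div_one] at this
      exact this.mono_left nhdsWithin_le_nhds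
    obtain ⟨ε, hbε, hε0, hε1⟩ := ((hlim.eventually (gt_mem_nhds hb)).and
      (Ioo_mem_nhdsGT (show (0 : ℝ) < 1 by norm_num))).exists
    filter_upwards [tendsto_natCast_atTop_atTop.eventually_ge_atTop ((1 + ε) ^ 3 / ε ^ 3),
      eventually_gt_atTop 0] with n hn1 hn
    have hn0 : (0 : ℝ) < n := by exact_mod_cast hn
    set s := (n : ℝ) ^ (1 / 3 : ℝ) with hs
    have hs0 : 0 < s := by positivity
    have hs3 : s ^ 3 = n := rpow_third_cube hn0.le
    have h1ε : 0 < 1 - ε := by linarith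
    rw [div_le_iff₀ (by positivity)] at hn1
    have k1 := hα1 ((1 + ε) * s) (by positivity)
    have k2 := mul_le_poissonMean h0 h1 hm hn (r := ((1 + ε) * s) ^ 3) hε0 (by
      rw [mul_pow, hs3]
      gcongr
      exact le_self_pow₀ (by linarith) (by norm_num))
    refine lt_of_le_of_lt ?_ hbε
    rw [div_le_div_iff₀ hs0 h1ε]
    have : ((1 + ε) * s) ^ 3 / (ε * n) ^ 2 ≤ ε := by
      rw [div_le_iff₀ (by positivity), mul_pow, hs3]
      nlinarith
    have := mul_le_mul_of_nonneg_left (sub_le_sub_left this 1) (h0 n)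
    linarith

/-! ### Convex independence through linear functionals -/

section

variable {E : Type*} [NormedAddCommGroup E] [NormedSpace ℝ E]

lemma eq_or_lt_of_mem_convexHull {s : Set E} {z w : E} (ℓ : E →L[ℝ] ℝ)
    (hs : ∀ y ∈ s, y = z ∨ ℓ y < ℓ z) (hw : w ∈ convexHull ℝ s) : w = z ∨ ℓ w < ℓ z := by
  have hc : Convex ℝ {y | y = z ∨ ℓ y < ℓ z} := by
    rw [convex_iff_forall_pos]
    intro x hx y hy a b ha hb hab
    rcases hx with rfl | hx
    · rcases hy with rfl | hy
      · left; rw [← add_smul, hab, one_smul]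
      · right
        have : ℓ x = a * ℓ x + b * ℓ x := by rw [← add_mul, hab, one_mul]
        simp only [map_add, map_smul, smul_eq_mul]
        nlinarith
    · right
      have h1 : ℓ z = a * ℓ z + b * ℓ z := by rw [← add_mul, hab, one_mul]
      have h2 : ℓ y ≤ ℓ z := by
        rcases hy with rfl | hy
        · rfl
        · exact hy.le
      simp only [map_add, map_smul, smul_eq_mul]
      nlinarith
  exact convexHull_min (fun y hy => hs y hy) hc hw

/-- A finite family is convex independent iff each member is strictly separated from the others
by a linear functional. -/
lemma convexIndependent_iff_exists_functional {ι : Type*} [Finite ι] {p : ι → E} :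
    ConvexIndependent ℝ p ↔ ∀ i, ∃ ℓ : E →L[ℝ] ℝ, ∀ j, j ≠ i → ℓ (p j) < ℓ (p i) := by
  constructor
  · intro h i
    have hi : p i ∉ convexHull ℝ (p '' {i}ᶜ) := fun hmem => h {i}ᶜ i hmem rfl
    obtain ⟨ℓ, u, h1, h2⟩ := geometric_hahn_banach_closed_point (convex_convexHull ℝ _)
      ((Set.toFinite (p '' {i}ᶜ)).isClosed_convexHull ℝ) hi
    exact ⟨ℓ, fun j hj => (h1 _ (subset_convexHull ℝ _ ⟨j, hj, rfl⟩)).trans h2⟩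
  · intro h s i hi
    by_contra his
    obtain ⟨ℓ, hℓ⟩ := h i
    have : convexHull ℝ (p '' s) ⊆ {y | ℓ y < ℓ (p i)} := by
      refine convexHull_min ?_ (convex_halfSpace_lt ℓ.toLinearMap.isLinear _)
      rintro _ ⟨j, hj, rfl⟩
      exact hℓ j (fun e => his (e ▸ hj))
    exact lt_irrefl (ℓ (p i)) (this hi)

lemma extremePoints_convexHull_range {ι : Type*} [Finite ι] {p : ι → E}
    (h : ConvexIndependent ℝ p) :
    (convexHull ℝ (Set.range p)).extremePoints ℝ = Set.range p := by
  refine extremePoints_convexHull_subset.antisymm ?_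
  rintro _ ⟨i, rfl⟩
  obtain ⟨ℓ, hℓ⟩ := convexIndependent_iff_exists_functional.1 h i
  have hs : ∀ y ∈ Set.range p, y = p i ∨ ℓ y < ℓ (p i) := by
    rintro _ ⟨j, rfl⟩
    rcases eq_or_ne j i with rfl | hj
    · exact Or.inl rfl
    · exact Or.inr (hℓ j hj)
  refine exposedPoints_subset_extremePoints
    ⟨subset_convexHull ℝ _ ⟨i, rfl⟩, ℓ, fun y hy => ?_⟩
  rcases eq_or_lt_of_mem_convexHull ℓ hs hy with rfl | hlt
  · exact ⟨le_rfl, fun _ => rfl⟩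
  · exact ⟨hlt.le, fun hle => absurd hlt (not_lt.2 hle)⟩

end

/-! ### Convex chains as indexed families -/

/-- The family `x` of points of the triangle is a convex chain from `p₀` to `p₂`: together with
`p₀` and `p₂` it is convex independent (so its members are distinct and different from `p₀`,
`p₂`). -/
def IsChainFamily (p₀ p₁ p₂ : Plane) {ι : Type*} (x : ι → Plane) : Prop :=
  (∀ i, x i ∈ triangle p₀ p₁ p₂) ∧ ConvexIndependent ℝ (Sum.elim x ![p₀, p₂])

section

variable {p₀ p₁ p₂ : Plane} {ι κ : Type*}

lemma IsChainFamily.comp {x : ι → Plane} (h : IsChainFamily p₀ p₁ p₂ x) (f : κ ↪ ι) :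
    IsChainFamily p₀ p₁ p₂ (x ∘ f) := by
  refine ⟨fun i => h.1 _, ?_⟩
  have := h.2.comp_embedding (f.sumMap (Function.Embedding.refl (Fin 2)))
  convert this using 1
  ext1 i
  cases i <;> rfl

lemma IsChainFamily.injective {x : ι → Plane} (h : IsChainFamily p₀ p₁ p₂ x) :
    Function.Injective x :=
  fun i j hij => Sum.inl_injective (h.2.injective (a₁ := Sum.inl i) (a₂ := Sum.inl j) hij)

lemma isClosed_triangle : IsClosed (triangle p₀ p₁ p₂) :=
  (Set.toFinite _).isClosed_convexHull ℝ

lemma measurableSet_isChainFamily [Finite ι] :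
    MeasurableSet {x : ι → Plane | IsChainFamily p₀ p₁ p₂ x} := by
  have := Fintype.ofFinite ι
  refine MeasurableSet.inter (s₁ := {x : ι → Plane | ∀ i, x i ∈ triangle p₀ p₁ p₂})
    (s₂ := {x : ι → Plane | ConvexIndependent ℝ (Sum.elim x ![p₀, p₂])}) ?_ ?_
  · refine IsClosed.measurableSet ?_
    rw [Set.ofPred_forall]
    exact isClosed_iInter fun i => isClosed_triangle.preimage (continuous_apply i)
  · refine IsOpen.measurableSet ?_
    simp only [convexIndependent_iff_exists_functional, Set.ofPred_forall, Set.ofPred_exists]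
    refine isOpen_iInter_of_finite fun i => isOpen_iUnion fun ℓ => isOpen_iInter_of_finite fun j =>
      isOpen_iInter_of_finite fun _ => ?_
    have hc : ∀ i : ι ⊕ Fin 2, Continuous fun x : ι → Plane => Sum.elim x ![p₀, p₂] i := by
      rintro (i | i)
      · exact continuous_apply i
      · exact continuous_const
    exact isOpen_lt (ℓ.continuous.comp (hc j)) (ℓ.continuous.comp (hc i))

lemma isChainFamily_of_isEmpty [IsEmpty ι] (h : p₀ ≠ p₂) (x : ι → Plane) :
    IsChainFamily p₀ p₁ p₂ x := by
  refine ⟨fun i => isEmptyElim i, convexIndependent_iff_exists_functional.2 ?_⟩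
  rintro (i | i)
  · exact isEmptyElim i
  · obtain ⟨ℓ, hℓ⟩ := geometric_hahn_banach_point_point h
    fin_cases i
    · refine ⟨-ℓ, ?_⟩
      rintro (j | j) hj
      · exact isEmptyElim j
      · fin_cases j
        · exact absurd rfl hj
        · simpa using hℓ
    · refine ⟨ℓ, ?_⟩
      rintro (j | j) hj
      · exact isEmptyElim j
      · fin_cases j
        · simpa using hℓ
        · exact absurd rfl hj

open Classical in
lemma range_sumElim_eq [Fintype ι] (x : ι → Plane) :
    Set.range (Sum.elim x ![p₀, p₂])
      = ((Finset.univ.image x : Finset Plane) : Set Plane) ∪ {p₀, p₂} := by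
  rw [Set.Sum.elim_range]
  simp [Matrix.range_cons, Matrix.range_empty, Set.pair_comm]

open Classical in
/-- The link between convex chains as finite sets and as indexed families. -/
lemma le_longestChain_iff [Fintype ι] (h : p₀ ≠ p₂) (x : ι → Plane) (k : ℕ) :
    k ≤ longestChain p₀ p₁ p₂ (Finset.univ.image x) ↔
      ∃ f : Fin k ↪ ι, IsChainFamily p₀ p₁ p₂ (x ∘ f) := by
  constructor
  · intro hk
    rcases Nat.eq_zero_or_pos k with rfl | hk0
    · exact ⟨⟨fun i => i.elim0, fun i => i.elim0⟩, isChainFamily_of_isEmpty h _⟩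
    · obtain ⟨Y, hY, hkY⟩ := (Finset.le_sup_iff hk0).1 hk
      simp only [Finset.mem_filter, Finset.mem_powerset] at hY
      obtain ⟨hYx, hYT, hYc⟩ := hY
      set Z : Set Plane := (Y : Set Plane) ∪ {p₀, p₂} with hZ
      have hZfin : Z.Finite := Y.finite_toSet.union (Set.toFinite _)
      have hZle : Z.ncard ≤ Y.card + 2 := by
        refine (Set.ncard_union_le _ _).trans ?_
        rw [Set.ncard_coe_finset]
        gcongr
        exact (Set.ncard_insert_le _ _).trans (by rw [Set.ncard_singleton])
      have hex : (convexHull ℝ Z).extremePoints ℝ = Z :=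
        Set.eq_of_subset_of_ncard_le extremePoints_convexHull_subset (by rw [hYc]; exact hZle) hZfin
      have hind : ConvexIndependent ℝ ((↑) : Z → Plane) := by
        have := (convex_convexHull ℝ Z).convexIndependent_extremePoints
        rwa [hex] at this
      rw [hex] at hYc
      -- the cardinality forces `p₀` and `p₂` to lie outside `Y`
      have hdisj : ∀ y ∈ Y, y ≠ p₀ ∧ y ≠ p₂ := by
        intro y hy
        have key : ∀ q, Z ⊆ (insert q Y : Finset Plane) → False := by
          intro q hq
          have h1 := Set.ncard_le_ncard hq (Finset.finite_toSet _)
          rw [Set.ncard_coe_finset, hYc] at h1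
          have := Finset.card_insert_le q Y
          lia
        constructor
        · rintro rfl
          refine key p₂ ?_
          rintro z (hz | rfl | hz) <;> simp_all
        · rintro rfl
          refine key p₀ ?_
          rintro z (hz | hz | hz) <;> simp_all
      have hpre : ∀ y : Y, ∃ i, x i = y := fun y => by
        simpa using hYx y.2
      choose g hg using hpre
      let e : Fin k ↪ Y := (Fin.castLEEmb hkY).trans Y.equivFin.symm.toEmbedding
      have hginj : Function.Injective g := fun y z hyz => by
        have := hg y
        rw [hyz, hg z] at this
        exact Subtype.ext this.symm
      have hxe : ∀ i, x (g (e i)) = e i := fun i => hg (e i)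
      refine ⟨e.trans ⟨g, hginj⟩, fun i => ?_, ?_⟩
      · have := hYT (e i).2
        rw [← hxe i] at this
        exact this
      · set G : Fin k ⊕ Fin 2 → Plane := Sum.elim (x ∘ (e.trans ⟨g, hginj⟩)) ![p₀, p₂] with hG
        have hGl : ∀ i, G (Sum.inl i) = e i := hxe
        have hGZ : ∀ i, G i ∈ Z := by
          rintro (i | i)
          · exact Or.inl (hGl i ▸ (e i).2)
          · fin_cases i
            · exact Or.inr (Or.inl rfl)
            · exact Or.inr (Or.inr rfl)
        have hne : ∀ i j, G (Sum.inl i) ≠ G (Sum.inr j) := by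
          intro i j hij
          rw [hGl] at hij
          fin_cases j
          · exact (hdisj _ (e i).2).1 hij
          · exact (hdisj _ (e i).2).2 hij
        have hGinj : Function.Injective G := by
          rintro (i | i) (j | j) hij
          · rw [hGl, hGl] at hij
            exact congrArg Sum.inl (e.injective (Subtype.ext hij))
          · exact absurd hij (hne i j)
          · exact absurd hij.symm (hne j i)
          · fin_cases i <;> fin_cases j
            · rfl
            · exact absurd hij h
            · exact absurd hij.symm h
            · rfl
        exact hind.comp_embedding ⟨fun i => ⟨G i, hGZ i⟩,
          fun i j hij => hGinj (congrArg Subtype.val hij)⟩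
  · rintro ⟨f, hf⟩
    have hcard : (Finset.univ.image (x ∘ f)).card = k := by
      rw [Finset.card_image_of_injective _ hf.injective]; simp
    have hmem : Finset.univ.image (x ∘ f) ∈ (Finset.univ.image x).powerset.filter
        fun Y => IsConvexChain p₀ p₁ p₂ Y := by
      simp only [Finset.mem_filter, Finset.mem_powerset]
      refine ⟨?_, ?_, ?_⟩
      · intro y hy
        simp only [Finset.mem_image, Finset.mem_univ, true_and] at hy ⊢
        obtain ⟨i, rfl⟩ := hy
        exact ⟨f i, rfl⟩
      · intro y hy
        simp only [Finset.coe_image, Finset.coe_univ, Set.image_univ, Set.mem_range] at hy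
        obtain ⟨i, rfl⟩ := hy
        exact hf.1 i
      · rw [← range_sumElim_eq, extremePoints_convexHull_range hf.2, hcard, ← Set.image_univ,
          Set.ncard_image_of_injective _ hf.2.injective, Set.ncard_univ]
        simp
    have := Finset.le_sup (f := Finset.card) hmem
    rwa [hcard] at this

/-! ### Concatenation of chains -/

/-- Cut the triangle at the tangent point `r` of parameter `t` of the parabola that touches its
sides at `p₀` and `p₂`. A chain in the corner triangle at `p₀` followed by a chain in the corner
triangle at `p₂` is a chain in the big triangle: a functional that exposes a point of the first
chain decreases along the tangent from `q₀` to `q₁`, hence stays below on the second triangle. -/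
lemma IsChainFamily.sumElim [Finite ι] [Finite κ] {q₀ q₁ r : Plane} {t : ℝ} (ht0 : 0 < t)
    (ht1 : t < 1) (hq₀ : q₀ = (1 - t) • p₀ + t • p₁) (hq₁ : q₁ = (1 - t) • p₁ + t • p₂)
    (hr : r = (1 - t) • q₀ + t • q₁)
    (h₀ : ∃ ℓ : Plane →L[ℝ] ℝ, ℓ p₁ < ℓ p₀ ∧ ℓ p₂ < ℓ p₀)
    (h₂ : ∃ ℓ : Plane →L[ℝ] ℝ, ℓ p₀ < ℓ p₂ ∧ ℓ p₁ < ℓ p₂)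
    {x : ι → Plane} {y : κ → Plane} (hx : IsChainFamily p₀ q₀ r x)
    (hy : IsChainFamily r q₁ p₂ y) : IsChainFamily p₀ p₁ p₂ (Sum.elim x y) := by
  have h1t : 0 < 1 - t := by linarith
  have hcT : Convex ℝ (triangle p₀ p₁ p₂) := convex_convexHull ℝ _
  have m0 : p₀ ∈ triangle p₀ p₁ p₂ := subset_convexHull ℝ _ (by simp)
  have m1 : p₁ ∈ triangle p₀ p₁ p₂ := subset_convexHull ℝ _ (by simp)
  have m2 : p₂ ∈ triangle p₀ p₁ p₂ := subset_convexHull ℝ _ (by simp)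
  have mq0 : q₀ ∈ triangle p₀ p₁ p₂ := hq₀ ▸ hcT m0 m1 h1t.le ht0.le (by ring)
  have mq1 : q₁ ∈ triangle p₀ p₁ p₂ := hq₁ ▸ hcT m1 m2 h1t.le ht0.le (by ring)
  have mr : r ∈ triangle p₀ p₁ p₂ := hr ▸ hcT mq0 mq1 h1t.le ht0.le (by ring)
  have sub1 : triangle p₀ q₀ r ⊆ triangle p₀ p₁ p₂ :=
    convexHull_min (by rintro z (rfl | rfl | rfl) <;> assumption) hcT
  have sub2 : triangle r q₁ p₂ ⊆ triangle p₀ p₁ p₂ :=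
    convexHull_min (by rintro z (rfl | rfl | rfl) <;> assumption) hcT
  have lq0 : ∀ ℓ : Plane →L[ℝ] ℝ, ℓ q₀ = (1 - t) * ℓ p₀ + t * ℓ p₁ := fun ℓ => by
    rw [hq₀]; simp
  have lq1 : ∀ ℓ : Plane →L[ℝ] ℝ, ℓ q₁ = (1 - t) * ℓ p₁ + t * ℓ p₂ := fun ℓ => by
    rw [hq₁]; simp
  have lr : ∀ ℓ : Plane →L[ℝ] ℝ, ℓ r = (1 - t) * ℓ q₀ + t * ℓ q₁ := fun ℓ => by
    rw [hr]; simp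
  -- maximum principle on a triangle
  have hmax : ∀ (ℓ : Plane →L[ℝ] ℝ) (a b c z : Plane) (M : ℝ), z ∈ triangle a b c → ℓ a < M →
      ℓ b < M → ℓ c < M → ℓ z < M := by
    intro ℓ a b c z M hz ha hb hc
    exact convexHull_min (t := {w | ℓ w < M}) (by rintro w (rfl | rfl | rfl) <;> assumption)
      (convex_halfSpace_lt ℓ.toLinearMap.isLinear _) hz
  have hx' := convexIndependent_iff_exists_functional.1 hx.2
  have hy' := convexIndependent_iff_exists_functional.1 hy.2
  refine ⟨?_, convexIndependent_iff_exists_functional.2 ?_⟩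
  · rintro (i | j)
    · exact sub1 (hx.1 i)
    · exact sub2 (hy.1 j)
  rintro ((i | j) | m)
  · obtain ⟨ℓ, hℓ⟩ := hx' (Sum.inl i)
    have e0 : ℓ p₀ < ℓ (x i) := by simpa using hℓ (Sum.inr 0) (by simp)
    have er : ℓ r < ℓ (x i) := by simpa using hℓ (Sum.inr 1) (by simp)
    have eq0 : ℓ (x i) ≤ ℓ q₀ := by
      by_contra! hlt
      exact lt_irrefl _ (hmax ℓ _ _ _ _ _ (hx.1 i) e0 hlt er)
    have a1 : ℓ p₀ < ℓ p₁ := by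
      have := lq0 ℓ
      by_contra! hle
      nlinarith
    have a2 : ℓ q₁ < ℓ q₀ := by
      have := lr ℓ
      by_contra! hle
      nlinarith
    have a3 : ℓ p₂ < ℓ p₁ := by
      rw [lq0, lq1] at a2
      by_contra! hle
      nlinarith [mul_pos h1t (sub_pos.2 a1), mul_nonneg ht0.le (sub_nonneg.2 hle)]
    have a4 : ℓ q₁ < ℓ r := by
      rw [lr]; nlinarith
    have a5 : ℓ p₂ < ℓ q₁ := by
      rw [lq1]; nlinarith
    refine ⟨ℓ, ?_⟩
    rintro ((i' | j') | m') hne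
    · exact hℓ (Sum.inl i') (fun e => hne (by rw [Sum.inl_injective e]))
    · exact hmax ℓ _ _ _ _ _ (hy.1 j') er (a4.trans er) ((a5.trans a4).trans er)
    · fin_cases m'
      · exact e0
      · exact (a5.trans a4).trans er
  · obtain ⟨ℓ, hℓ⟩ := hy' (Sum.inl j)
    have er : ℓ r < ℓ (y j) := by simpa using hℓ (Sum.inr 0) (by simp)
    have e2 : ℓ p₂ < ℓ (y j) := by simpa using hℓ (Sum.inr 1) (by simp)
    have eq1 : ℓ (y j) ≤ ℓ q₁ := by
      by_contra! hlt
      exact lt_irrefl _ (hmax ℓ _ _ _ _ _ (hy.1 j) er hlt e2)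
    have a1 : ℓ p₂ < ℓ p₁ := by
      have := lq1 ℓ
      by_contra! hle
      nlinarith
    have a2 : ℓ q₀ < ℓ q₁ := by
      have := lr ℓ
      by_contra! hle
      nlinarith
    have a3 : ℓ p₀ < ℓ p₁ := by
      rw [lq0, lq1] at a2
      by_contra! hle
      nlinarith [mul_pos ht0 (sub_pos.2 a1), mul_nonneg h1t.le (sub_nonneg.2 hle)]
    have a4 : ℓ q₀ < ℓ r := by
      rw [lr]; nlinarith
    have a5 : ℓ p₀ < ℓ q₀ := by
      rw [lq0]; nlinarith
    refine ⟨ℓ, ?_⟩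
    rintro ((i' | j') | m') hne
    · exact hmax ℓ _ _ _ _ _ (hx.1 i') ((a5.trans a4).trans er) (a4.trans er) er
    · exact hℓ (Sum.inl j') (fun e => hne (by rw [Sum.inl_injective e]))
    · fin_cases m'
      · exact (a5.trans a4).trans er
      · exact e2
  · fin_cases m
    · obtain ⟨ℓ, b1, b2⟩ := h₀
      have c0 : ℓ q₀ < ℓ p₀ := by rw [lq0]; nlinarith
      have c1 : ℓ q₁ < ℓ p₀ := by rw [lq1]; nlinarith
      have cr : ℓ r < ℓ p₀ := by rw [lr]; nlinarith
      refine ⟨ℓ, ?_⟩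
      rintro ((i' | j') | m') hne
      · refine (eq_or_lt_of_mem_convexHull (z := p₀) ℓ ?_ (hx.1 i')).resolve_left fun e => ?_
        · rintro w (rfl | rfl | rfl)
          · exact Or.inl rfl
          · exact Or.inr c0
          · exact Or.inr cr
        · exact Sum.inl_ne_inr (hx.2.injective (a₁ := Sum.inl i') (a₂ := Sum.inr 0) e)
      · exact hmax ℓ _ _ _ _ _ (hy.1 j') cr c1 b2
      · fin_cases m'
        · exact absurd rfl hne
        · exact b2
    · obtain ⟨ℓ, b0, b1⟩ := h₂
      have c0 : ℓ q₀ < ℓ p₂ := by rw [lq0]; nlinarith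
      have c1 : ℓ q₁ < ℓ p₂ := by rw [lq1]; nlinarith
      have cr : ℓ r < ℓ p₂ := by rw [lr]; nlinarith
      refine ⟨ℓ, ?_⟩
      rintro ((i' | j') | m') hne
      · exact hmax ℓ _ _ _ _ _ (hx.1 i') b0 c0 cr
      · refine (eq_or_lt_of_mem_convexHull (z := p₂) ℓ ?_ (hy.1 j')).resolve_left fun e => ?_
        · rintro w (rfl | rfl | rfl)
          · exact Or.inr cr
          · exact Or.inr c1
          · exact Or.inl rfl
        · exact Sum.inl_ne_inr (hy.2.injective (a₁ := Sum.inl j') (a₂ := Sum.inr 1) e)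
      · fin_cases m'
        · exact b0
        · exact absurd rfl hne

open Classical in
lemma longestChain_add_le [Fintype ι] {q₀ q₁ r : Plane} {t : ℝ} (ht0 : 0 < t)
    (ht1 : t < 1) (hq₀ : q₀ = (1 - t) • p₀ + t • p₁) (hq₁ : q₁ = (1 - t) • p₁ + t • p₂)
    (hr : r = (1 - t) • q₀ + t • q₁)
    (h₀ : ∃ ℓ : Plane →L[ℝ] ℝ, ℓ p₁ < ℓ p₀ ∧ ℓ p₂ < ℓ p₀)
    (h₂ : ∃ ℓ : Plane →L[ℝ] ℝ, ℓ p₀ < ℓ p₂ ∧ ℓ p₁ < ℓ p₂)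
    (hp₀r : p₀ ≠ r) (hrp₂ : r ≠ p₂) (x : ι → Plane) :
    longestChain p₀ q₀ r (Finset.univ.image x) + longestChain r q₁ p₂ (Finset.univ.image x)
      ≤ longestChain p₀ p₁ p₂ (Finset.univ.image x) := by
  have h : p₀ ≠ p₂ := by
    rintro rfl
    obtain ⟨ℓ, -, h⟩ := h₀
    exact lt_irrefl _ h
  obtain ⟨f, hf⟩ := (le_longestChain_iff hp₀r x _).1 le_rfl
  obtain ⟨g, hg⟩ := (le_longestChain_iff hrp₂ x _).1 le_rfl
  have hfg := hf.sumElim ht0 ht1 hq₀ hq₁ hr h₀ h₂ hg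
  rw [← Sum.comp_elim] at hfg
  rw [le_longestChain_iff h]
  refine ⟨finSumFinEquiv.symm.toEmbedding.trans ⟨_, hfg.injective.of_comp⟩, ?_⟩
  exact hfg.comp finSumFinEquiv.symm.toEmbedding

end

/-! ### Affine images of the standard triangle -/

/-- The vertex `(0, 0)` of the standard triangle. -/
noncomputable def std₀ : Plane := !₂[0, 0]

/-- The vertex `(1, 0)` of the standard triangle. -/
noncomputable def std₁ : Plane := !₂[1, 0]

/-- The vertex `(1, 1)` of the standard triangle. -/
noncomputable def std₂ : Plane := !₂[1, 1]

lemma mem_triangle_std {z : Plane} :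
    z ∈ triangle std₀ std₁ std₂ ↔ 0 ≤ z 1 ∧ z 1 ≤ z 0 ∧ z 0 ≤ 1 := by
  constructor
  · intro hz
    have hc : Convex ℝ {z : Plane | 0 ≤ z 1 ∧ z 1 ≤ z 0 ∧ z 0 ≤ 1} := by
      rintro x ⟨hx1, hx2, hx3⟩ y ⟨hy1, hy2, hy3⟩ a b ha hb hab
      refine ⟨?_, ?_, ?_⟩ <;> simp <;> nlinarith
    refine convexHull_min ?_ hc hz
    rintro w (rfl | rfl | rfl) <;> refine ⟨?_, ?_, ?_⟩ <;> simp [std₀, std₁, std₂]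
  · rintro ⟨h1, h2, h3⟩
    have := (convex_convexHull ℝ {std₀, std₁, std₂}).sum_mem (t := (Finset.univ : Finset (Fin 3)))
      (w := ![1 - z 0, z 0 - z 1, z 1]) (z := ![std₀, std₁, std₂]) ?_ ?_ ?_
    · have e : ∑ i : Fin 3, (![1 - z 0, z 0 - z 1, z 1] : Fin 3 → ℝ) i •
          (![std₀, std₁, std₂] : Fin 3 → Plane) i = z := by
        ext i
        fin_cases i <;> simp [Fin.sum_univ_three, std₀, std₁, std₂]
      rwa [e] at this
    · intro i _
      fin_cases i <;> simp <;> linarith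
    · simp [Fin.sum_univ_three]
    · intro i _
      refine subset_convexHull ℝ _ ?_
      fin_cases i <;> simp

/-- The linear part of `triangleMap`. -/
noncomputable def triangleLin (q₀ q₁ q₂ : Plane) : Plane →ₗ[ℝ] Plane :=
  (EuclideanSpace.proj (0 : Fin 2) : Plane →L[ℝ] ℝ).toLinearMap.smulRight (q₁ - q₀) +
    (EuclideanSpace.proj (1 : Fin 2) : Plane →L[ℝ] ℝ).toLinearMap.smulRight (q₂ - q₁)

/-- The affine map that sends the standard triangle to the triangle `q₀ q₁ q₂`. -/
noncomputable def triangleMap (q₀ q₁ q₂ : Plane) : Plane →ᵃ[ℝ] Plane :=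
  (triangleLin q₀ q₁ q₂).toAffineMap + AffineMap.const ℝ Plane q₀

/-- Twice the signed area of the triangle `q₀ q₁ q₂`. -/
def triangleDet (q₀ q₁ q₂ : Plane) : ℝ :=
  (q₁ 0 - q₀ 0) * (q₂ 1 - q₁ 1) - (q₁ 1 - q₀ 1) * (q₂ 0 - q₁ 0)

section

variable {q₀ q₁ q₂ : Plane}

lemma triangleLin_apply (z : Plane) :
    triangleLin q₀ q₁ q₂ z = z 0 • (q₁ - q₀) + z 1 • (q₂ - q₁) := by
  simp [triangleLin]

lemma triangleMap_apply (z : Plane) :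
    triangleMap q₀ q₁ q₂ z = triangleLin q₀ q₁ q₂ z + q₀ := by
  simp [triangleMap]

lemma triangleMap_std₀ : triangleMap q₀ q₁ q₂ std₀ = q₀ := by
  simp [triangleMap_apply, triangleLin_apply, std₀]

lemma triangleMap_std₁ : triangleMap q₀ q₁ q₂ std₁ = q₁ := by
  simp [triangleMap_apply, triangleLin_apply, std₁]

lemma triangleMap_std₂ : triangleMap q₀ q₁ q₂ std₂ = q₂ := by
  simp [triangleMap_apply, triangleLin_apply, std₂]

lemma det_triangleLin : LinearMap.det (triangleLin q₀ q₁ q₂) = triangleDet q₀ q₁ q₂ := by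
  rw [← LinearMap.det_toMatrix (EuclideanSpace.basisFun (Fin 2) ℝ).toBasis, Matrix.det_fin_two]
  simp [LinearMap.toMatrix_apply, triangleLin_apply, triangleDet]
  ring

lemma image_triangleMap :
    triangleMap q₀ q₁ q₂ '' triangle std₀ std₁ std₂ = triangle q₀ q₁ q₂ := by
  unfold triangle
  rw [AffineMap.image_convexHull, Set.image_insert_eq, Set.image_pair, triangleMap_std₀,
    triangleMap_std₁, triangleMap_std₂]

lemma triangleMap_injective (h : triangleDet q₀ q₁ q₂ ≠ 0) :
    Function.Injective (triangleMap q₀ q₁ q₂) := by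
  intro x y hxy
  rw [triangleMap_apply, triangleMap_apply, add_left_inj] at hxy
  rw [← det_triangleLin] at h
  exact (LinearMap.equivOfDetNeZero (triangleLin q₀ q₁ q₂) h).injective hxy

lemma measurable_triangleMap : Measurable (triangleMap q₀ q₁ q₂) :=
  (AffineMap.continuous_of_finiteDimensional _).measurable

lemma volume_preimage_triangleMap (h : triangleDet q₀ q₁ q₂ ≠ 0) (s : Set Plane) :
    volume (triangleMap q₀ q₁ q₂ ⁻¹' s)
      = ENNReal.ofReal |(triangleDet q₀ q₁ q₂)⁻¹| * volume s := by
  have e : triangleMap q₀ q₁ q₂ ⁻¹' s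
      = triangleLin q₀ q₁ q₂ ⁻¹' ((fun z => z + q₀) ⁻¹' s) := by
    ext z
    simp [triangleMap_apply]
  rw [e, Measure.addHaar_preimage_linearMap _ (by rwa [det_triangleLin]), det_triangleLin,
    measure_preimage_add_right]

lemma volume_triangle (h : triangleDet q₀ q₁ q₂ ≠ 0) :
    volume (triangle q₀ q₁ q₂)
      = ENNReal.ofReal |triangleDet q₀ q₁ q₂| * volume (triangle std₀ std₁ std₂) := by
  have := volume_preimage_triangleMap h (triangle q₀ q₁ q₂)
  rw [← image_triangleMap, Set.preimage_image_eq _ (triangleMap_injective h)] at this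
  rw [this, ← mul_assoc, ← ENNReal.ofReal_mul (abs_nonneg _), ← abs_mul, mul_inv_cancel₀ h,
    image_triangleMap]
  simp

lemma volume_triangle_ne_top {p₀ p₁ p₂ : Plane} : volume (triangle p₀ p₁ p₂) ≠ ⊤ :=
  ((Set.toFinite _).isCompact_convexHull ℝ).measure_lt_top.ne

/-- The standard triangle and its mirror image, which has the same area, cover the unit square. -/
lemma half_le_volume_std : 1 ≤ 2 * volume (triangle std₀ std₁ std₂) := by
  have hdet : triangleDet std₀ !₂[0, 1] std₂ = -1 := by simp [triangleDet, std₀, std₂]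
  have hv := volume_triangle (q₀ := std₀) (q₁ := !₂[0, 1]) (q₂ := std₂) (by rw [hdet]; norm_num)
  rw [hdet] at hv
  simp only [abs_neg, abs_one, ENNReal.ofReal_one, one_mul] at hv
  have hsq : volume {z : Plane | z.ofLp ∈ Set.Icc (0 : Fin 2 → ℝ) 1} = 1 := by
    have := (PiLp.volume_preserving_ofLp (Fin 2)).measure_preimage
      (measurableSet_Icc (a := (0 : Fin 2 → ℝ)) (b := 1)).nullMeasurableSet
    rw [Real.volume_Icc_pi] at this
    exact this.trans (by simp)
  rw [← hsq, two_mul]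
  nth_rw 2 [← hv]
  refine (measure_mono ?_).trans (measure_union_le _ _)
  rintro z ⟨hz0, hz1⟩
  have a0 := hz0 0
  have a1 := hz0 1
  have b0 := hz1 0
  have b1 := hz1 1
  simp only [Pi.zero_apply, Pi.one_apply] at a0 a1 b0 b1
  rcases le_total (z 1) (z 0) with hle | hle
  · exact Or.inl (mem_triangle_std.2 ⟨a1, hle, b0⟩)
  · right
    rw [← image_triangleMap]
    refine ⟨!₂[z 1, z 0], mem_triangle_std.2 ⟨by simpa, by simpa, by simpa⟩, ?_⟩
    ext i
    fin_cases i <;> simp [triangleMap_apply, triangleLin_apply, std₀, std₂]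

lemma volume_std_ne_zero : volume (triangle std₀ std₁ std₂) ≠ 0 := by
  intro h
  have := half_le_volume_std
  simp [h] at this

lemma volume_triangle_ne_zero (h : triangleDet q₀ q₁ q₂ ≠ 0) :
    volume (triangle q₀ q₁ q₂) ≠ 0 := by
  rw [volume_triangle h]
  exact mul_ne_zero (by simpa using h) volume_std_ne_zero

lemma isProbabilityMeasure_uniformTriangle (h : triangleDet q₀ q₁ q₂ ≠ 0) :
    IsProbabilityMeasure (uniformTriangle q₀ q₁ q₂) :=
  cond_isProbabilityMeasure_of_finite (volume_triangle_ne_zero h) volume_triangle_ne_top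

lemma triangleDet_std : triangleDet std₀ std₁ std₂ = 1 := by
  simp [triangleDet, std₀, std₁, std₂]

instance : IsProbabilityMeasure (uniformTriangle std₀ std₁ std₂) :=
  isProbabilityMeasure_uniformTriangle (by rw [triangleDet_std]; norm_num)

/-- The affine map between triangles transports the uniform distributions. -/
lemma measurePreserving_triangleMap (h : triangleDet q₀ q₁ q₂ ≠ 0) :
    MeasurePreserving (triangleMap q₀ q₁ q₂) (uniformTriangle std₀ std₁ std₂)
      (uniformTriangle q₀ q₁ q₂) := by
  refine ⟨measurable_triangleMap, ?_⟩
  ext s hs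
  have hinj := triangleMap_injective h
  have hpre : triangle std₀ std₁ std₂ ∩ triangleMap q₀ q₁ q₂ ⁻¹' s
      = triangleMap q₀ q₁ q₂ ⁻¹' (triangle q₀ q₁ q₂ ∩ s) := by
    rw [Set.preimage_inter, ← image_triangleMap (q₀ := q₀), Set.preimage_image_eq _ hinj]
  have hd : ENNReal.ofReal |(triangleDet q₀ q₁ q₂)⁻¹| ≠ 0 := by simpa using h
  rw [Measure.map_apply measurable_triangleMap hs]
  unfold uniformTriangle
  rw [cond_apply isClosed_triangle.measurableSet, cond_apply isClosed_triangle.measurableSet,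
    hpre, volume_preimage_triangleMap h, volume_triangle h, abs_inv,
    ENNReal.ofReal_inv_of_pos (abs_pos.2 h),
    ENNReal.mul_inv (Or.inr volume_triangle_ne_top) (Or.inr volume_std_ne_zero)]
  ring

lemma triangleDet_ne_zero (h : AffineIndependent ℝ ![q₀, q₁, q₂]) : triangleDet q₀ q₁ q₂ ≠ 0 := by
  intro hD
  have key : ∀ a b : ℝ, a * (q₁ 0 - q₀ 0) + b * (q₂ 0 - q₁ 0) = 0 →
      a * (q₁ 1 - q₀ 1) + b * (q₂ 1 - q₁ 1) = 0 → a = 0 ∧ b = 0 := by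
    intro a b h0 h1
    have := (affineIndependent_iff.1 h) Finset.univ ![-a, a - b, b]
      (by simp [Fin.sum_univ_three]; ring) (by
        ext i
        fin_cases i <;> simp [Fin.sum_univ_three] <;> linarith)
    exact ⟨by simpa using this 0 (by simp), by simpa using this 2 (by simp)⟩
  unfold triangleDet at hD
  obtain ⟨h1, h2⟩ := key (q₂ 0 - q₁ 0) (-(q₁ 0 - q₀ 0)) (by ring) (by linarith)
  obtain ⟨h3, h4⟩ := key (q₂ 1 - q₁ 1) (-(q₁ 1 - q₀ 1)) (by linarith) (by ring)
  have := key 1 0 (by linarith) (by linarith)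
  simp at this

lemma isChainFamily_triangleMap_iff (h : triangleDet q₀ q₁ q₂ ≠ 0) {ι : Type*} {x : ι → Plane} :
    IsChainFamily q₀ q₁ q₂ (triangleMap q₀ q₁ q₂ ∘ x) ↔ IsChainFamily std₀ std₁ std₂ x := by
  have hinj := triangleMap_injective h
  refine and_congr (forall_congr' fun i => ?_) ?_
  · rw [← image_triangleMap, Function.comp_apply, hinj.mem_set_image]
  · have e : Sum.elim (triangleMap q₀ q₁ q₂ ∘ x) ![q₀, q₂]
        = triangleMap q₀ q₁ q₂ ∘ Sum.elim x ![std₀, std₂] := by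
      rw [Sum.comp_elim]
      congr 1
      ext1 i
      fin_cases i <;> simp [triangleMap_std₀, triangleMap_std₂]
    rw [e]
    refine forall_congr' fun s => forall_congr' fun i => ?_
    rw [Set.image_comp, ← AffineMap.image_convexHull, Function.comp_apply, hinj.mem_set_image]

end

/-! ### The length of the longest chain of a family of points -/

open Classical in
/-- The length of the longest convex chain among the points of a finite family. For families
indexed by `Fin n` this is `chainLength`. -/
noncomputable def familyLength (p₀ p₁ p₂ : Plane) {ι : Type*} [Fintype ι] (x : ι → Plane) : ℝ :=
  (longestChain p₀ p₁ p₂ (Finset.univ.image x) : ℝ)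

section

variable {p₀ p₁ p₂ : Plane} {ι κ : Type*} [Fintype ι] [Fintype κ]

open Classical in
lemma natCast_le_familyLength_iff (h : p₀ ≠ p₂) (x : ι → Plane) (k : ℕ) :
    (k : ℝ) ≤ familyLength p₀ p₁ p₂ x ↔ ∃ f : Fin k ↪ ι, IsChainFamily p₀ p₁ p₂ (x ∘ f) := by
  rw [← le_longestChain_iff h, familyLength, Nat.cast_le]

/-- Comparison of longest chains through the sizes of the chains that the families contain. -/
lemma familyLength_le_of_forall (h : p₀ ≠ p₂) {q₀ q₁ q₂ : Plane} (hq : q₀ ≠ q₂) {x : ι → Plane}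
    {y : κ → Plane} (H : ∀ (k : ℕ) (f : Fin k ↪ ι), IsChainFamily p₀ p₁ p₂ (x ∘ f) →
      ∃ g : Fin k ↪ κ, IsChainFamily q₀ q₁ q₂ (y ∘ g)) :
    familyLength p₀ p₁ p₂ x ≤ familyLength q₀ q₁ q₂ y := by
  obtain ⟨f, hf⟩ := (natCast_le_familyLength_iff (p₁ := p₁) h x _).1 (le_refl (familyLength p₀ p₁ p₂ x))
  exact (natCast_le_familyLength_iff hq y _).2 (H _ f hf)

lemma familyLength_nonneg (x : ι → Plane) : 0 ≤ familyLength p₀ p₁ p₂ x := Nat.cast_nonneg _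

lemma familyLength_le_card (h : p₀ ≠ p₂) (x : ι → Plane) :
    familyLength p₀ p₁ p₂ x ≤ Fintype.card ι := by
  obtain ⟨f, -⟩ := (natCast_le_familyLength_iff (p₁ := p₁) h x _).1
    (le_refl (familyLength p₀ p₁ p₂ x))
  have := Fintype.card_le_of_embedding f
  rw [Fintype.card_fin] at this
  exact Nat.cast_le.2 this

lemma familyLength_comp_le (h : p₀ ≠ p₂) (x : ι → Plane) (e : κ ↪ ι) :
    familyLength p₀ p₁ p₂ (x ∘ e) ≤ familyLength p₀ p₁ p₂ x :=
  familyLength_le_of_forall h h fun _ f hf => ⟨f.trans e, hf⟩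

/-- Only the members of the family that lie in the triangle matter. -/
lemma familyLength_comp_eq (h : p₀ ≠ p₂) (x : ι → Plane) (e : κ ↪ ι)
    (he : ∀ i, x i ∈ triangle p₀ p₁ p₂ → i ∈ Set.range e) :
    familyLength p₀ p₁ p₂ (x ∘ e) = familyLength p₀ p₁ p₂ x := by
  refine (familyLength_comp_le h x e).antisymm (familyLength_le_of_forall h h fun k f hf => ?_)
  choose g hg using fun i => he (f i) (hf.1 i)
  refine ⟨⟨g, fun i j hij => f.injective ?_⟩, ?_⟩
  · rw [← hg i, ← hg j, hij]
  · convert hf using 1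
    ext1 i
    exact congrArg x (hg i)

lemma measurable_familyLength (h : p₀ ≠ p₂) :
    Measurable (familyLength p₀ p₁ p₂ : (ι → Plane) → ℝ) := by
  classical
  refine (measurable_of_countable (fun n : ℕ => (n : ℝ))).comp (measurable_of_Ici fun k => ?_)
  have : (fun x : ι → Plane => longestChain p₀ p₁ p₂ (Finset.univ.image x)) ⁻¹' Set.Ici k
      = ⋃ f : Fin k ↪ ι, (fun x : ι → Plane => x ∘ f) ⁻¹' {y | IsChainFamily p₀ p₁ p₂ y} := by
    ext x
    simp only [Set.mem_preimage, Set.mem_Ici, Set.mem_iUnion]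
    exact le_longestChain_iff h x k
  rw [this]
  exact MeasurableSet.iUnion fun f => measurableSet_isChainFamily.preimage
    (measurable_pi_lambda _ fun i => measurable_pi_apply _)

lemma integrable_familyLength (h : p₀ ≠ p₂) (μ : Measure (ι → Plane)) [IsFiniteMeasure μ] :
    Integrable (familyLength p₀ p₁ p₂) μ := by
  refine Integrable.of_bound (measurable_familyLength h).aestronglyMeasurable (Fintype.card ι)
    (ae_of_all _ fun x => ?_)
  rw [Real.norm_of_nonneg (familyLength_nonneg x)]
  exact familyLength_le_card h x

end

/-! ### Random restriction of a sample to a subtriangle -/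

lemma pi_const_smul {ι α : Type*} [Fintype ι] [MeasurableSpace α] (ν : Measure α) [IsFiniteMeasure ν]
    {c : ENNReal} (hc : c ≠ ⊤) :
    Measure.pi (fun _ : ι => c • ν) = c ^ Fintype.card ι • Measure.pi (fun _ : ι => ν) := by
  have : IsFiniteMeasure (c • ν) := ν.smul_finite hc
  refine (Measure.pi_eq fun s _ => ?_)
  rw [Measure.smul_apply, Measure.pi_pi]
  simp [Finset.prod_mul_distrib]

/-- The expected length of the longest chain in a sample of `k` independent points of law `ν`. -/
noncomputable def meanLength (p₀ p₁ p₂ : Plane) (ν : Measure Plane) (k : ℕ) : ℝ :=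
  ∫ x : Fin k → Plane, familyLength p₀ p₁ p₂ x ∂Measure.pi fun _ => ν

section

variable {p₀ p₁ p₂ : Plane}

lemma integral_familyLength_eq_meanLength (h : p₀ ≠ p₂) {ι : Type*} [Fintype ι] (ν : Measure Plane)
    [SigmaFinite ν] :
    ∫ x : ι → Plane, familyLength p₀ p₁ p₂ x ∂Measure.pi (fun _ => ν)
      = meanLength p₀ p₁ p₂ ν (Fintype.card ι) := by
  have e := (Fintype.equivFin ι)
  have := (measurePreserving_piCongrLeft (fun _ : Fin (Fintype.card ι) => ν) e).integral_comp'
    (familyLength p₀ p₁ p₂)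
  rw [meanLength, ← this]
  congr 1
  ext1 x
  rw [← familyLength_comp_eq h (MeasurableEquiv.piCongrLeft (fun _ => Plane) e x) e.toEmbedding
    (fun i _ => e.surjective i)]
  congr 1
  ext1 i
  exact (MeasurableEquiv.piCongrLeft_apply_apply (β := fun _ => Plane) e x i).symm

lemma setIntegral_familyLength (h : p₀ ≠ p₂) {ι : Type*} [Fintype ι] (μ : Measure Plane)
    [IsProbabilityMeasure μ] :
    ∫ x in Set.univ.pi fun _ : ι => triangle p₀ p₁ p₂, familyLength p₀ p₁ p₂ x
        ∂Measure.pi (fun _ => μ)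
      = μ.real (triangle p₀ p₁ p₂) ^ Fintype.card ι
        * meanLength p₀ p₁ p₂ (ProbabilityTheory.cond μ (triangle p₀ p₁ p₂)) (Fintype.card ι) := by
  set B := triangle p₀ p₁ p₂ with hB
  rw [Measure.restrict_pi_pi]
  have e : μ.restrict B = μ B • ProbabilityTheory.cond μ B := by
    rcases eq_or_ne (μ B) 0 with h0 | h0
    · rw [h0, zero_smul, Measure.restrict_eq_zero.2 h0]
    · rw [ProbabilityTheory.cond, smul_smul, ENNReal.mul_inv_cancel h0 (measure_ne_top _ _), one_smul]
  rw [e, pi_const_smul _ (measure_ne_top _ _), integral_smul_measure,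
    integral_familyLength_eq_meanLength h]
  simp [Measure.real]

/-- The part of a sample of `n` independent points of law `μ` that falls into a triangle is a
sample of the conditional law, with a binomial number of points. -/
lemma meanLength_eq_binomMean (h : p₀ ≠ p₂) (μ : Measure Plane) [IsProbabilityMeasure μ] (n : ℕ) :
    meanLength p₀ p₁ p₂ μ n = binomMean (meanLength p₀ p₁ p₂ (ProbabilityTheory.cond μ (triangle p₀ p₁ p₂))) n
      (μ.real (triangle p₀ p₁ p₂)) := by
  classical
  set B := triangle p₀ p₁ p₂ with hB
  have hBm : MeasurableSet B := isClosed_triangle.measurableSet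
  set p := μ.real B with hp
  -- the event that exactly the points with index in `S` fall into the triangle
  set E : Finset (Fin n) → Set (Fin n → Plane) := fun S => {x | ∀ i, x i ∈ B ↔ i ∈ S} with hE
  have hEm : ∀ S, MeasurableSet (E S) := by
    intro S
    have : E S = Set.univ.pi fun i => if i ∈ S then B else Bᶜ := by
      ext x
      simp only [hE, Set.mem_univ_pi]
      refine forall_congr' fun i => ?_
      split_ifs with hi <;> simp [hi]
    rw [this]
    refine MeasurableSet.univ_pi fun i => ?_
    split_ifs
    · exact hBm
    · exact hBm.compl
  have hsum : ∀ x : Fin n → Plane, familyLength p₀ p₁ p₂ x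
      = ∑ S : Finset (Fin n), (E S).indicator (familyLength p₀ p₁ p₂) x := by
    intro x
    rw [Finset.sum_eq_single (Finset.univ.filter fun i => x i ∈ B)]
    · rw [Set.indicator_of_mem]
      intro i
      simp
    · intro S _ hS
      refine Set.indicator_of_notMem (fun hx => hS ?_) _
      ext i
      simp [hx i]
    · simp
  have hterm : ∀ S : Finset (Fin n),
      ∫ x, (E S).indicator (familyLength p₀ p₁ p₂) x ∂Measure.pi (fun _ : Fin n => μ)
        = p ^ S.card * (1 - p) ^ (n - S.card) * meanLength p₀ p₁ p₂ (ProbabilityTheory.cond μ B) S.card := by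
    intro S
    obtain ⟨P, hPS⟩ : ∃ P : Fin n → Prop, ∀ i, P i ↔ i ∈ S := ⟨(· ∈ S), fun _ => Iff.rfl⟩
    have hmp := measurePreserving_piEquivPiSubtypeProd (fun _ : Fin n => μ) P
    let F : ({i // P i} → Plane) → ℝ :=
      (Set.univ.pi fun _ => B).indicator (familyLength p₀ p₁ p₂)
    let G : ({i // ¬ P i} → Plane) → ℝ := (Set.univ.pi fun _ => Bᶜ).indicator 1
    have h1 : ∀ x, (E S).indicator (familyLength p₀ p₁ p₂) x
        = (fun z : ({i // P i} → Plane) × ({i // ¬ P i} → Plane) => F z.1 * G z.2)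
          (MeasurableEquiv.piEquivPiSubtypeProd (fun _ : Fin n => Plane) P x) := by
      intro x
      change _ = F (fun i => x i) * G (fun i => x i)
      by_cases hx : x ∈ E S
      · rw [Set.indicator_of_mem hx]
        have hF : F (fun i => x i) = familyLength p₀ p₁ p₂ fun i : {i // P i} => x i :=
          Set.indicator_of_mem (s := Set.univ.pi fun _ : {i // P i} => B)
            (fun i _ => (hx i).2 ((hPS i).1 i.2)) _
        have hG : G (fun i => x i) = 1 :=
          Set.indicator_of_mem (s := Set.univ.pi fun _ : {i // ¬ P i} => Bᶜ)
            (fun i _ hi => i.2 ((hPS i).2 ((hx i).1 hi))) _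
        rw [hF, hG, mul_one]
        exact (familyLength_comp_eq h x (Function.Embedding.subtype P)
          (fun i hi => ⟨⟨i, (hPS i).2 ((hx i).1 hi)⟩, rfl⟩)).symm
      · rw [Set.indicator_of_notMem hx]
        by_cases hF : (fun i : {i // P i} => x i) ∈ (Set.univ.pi fun _ => B)
        · have hG : G (fun i => x i) = 0 := by
            refine Set.indicator_of_notMem (fun hG => hx fun i => ⟨fun hi => ?_, fun hi => ?_⟩) _
            · by_contra hiS
              exact hG ⟨i, fun hPi => hiS ((hPS i).1 hPi)⟩ trivial hi
            · exact hF ⟨i, (hPS i).2 hi⟩ trivial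
          rw [hG, mul_zero]
        · have hF : F (fun i => x i) = 0 := Set.indicator_of_notMem hF _
          rw [hF, zero_mul]
    simp_rw [h1]
    rw [hmp.integral_comp' (fun z : ({i // P i} → Plane) × ({i // ¬ P i} → Plane) => F z.1 * G z.2),
      integral_prod_mul]
    have hcard : Fintype.card {i // P i} = S.card :=
      Fintype.card_of_subtype S fun i => (hPS i).symm
    have hcard' : Fintype.card {i // ¬ P i} = n - S.card := by
      rw [Fintype.card_subtype_compl, hcard, Fintype.card_fin]
    have hFi : ∫ y, F y ∂Measure.pi (fun _ => μ) = p ^ S.card * meanLength p₀ p₁ p₂ (ProbabilityTheory.cond μ B) S.card := by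
      rw [integral_indicator (MeasurableSet.univ_pi fun _ => hBm), setIntegral_familyLength h, hcard]
    have hGi : ∫ y, G y ∂Measure.pi (fun _ => μ) = (1 - p) ^ (n - S.card) := by
      rw [integral_indicator_one (MeasurableSet.univ_pi fun _ => hBm.compl), Measure.real,
        Measure.pi_pi, Finset.prod_const, Finset.card_univ, hcard', ENNReal.toReal_pow]
      congr 1
      exact probReal_compl_eq_one_sub hBm
    refine Eq.trans (congrArg₂ HMul.hMul hFi hGi) ?_
    ring
  have hmean : meanLength p₀ p₁ p₂ μ n = ∑ S : Finset (Fin n),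
      p ^ S.card * (1 - p) ^ (n - S.card) * meanLength p₀ p₁ p₂ (ProbabilityTheory.cond μ B) S.card := by
    unfold meanLength
    simp_rw [hsum]
    rw [integral_finsetSum _ fun S _ => (integrable_familyLength h _).indicator (hEm S)]
    exact Finset.sum_congr rfl fun S _ => hterm S
  rw [hmean, binomMean, ← Finset.powerset_univ,
    Finset.sum_powerset_apply_card (fun k => p ^ k * (1 - p) ^ (n - k)
      * meanLength p₀ p₁ p₂ (ProbabilityTheory.cond μ B) k), Finset.card_univ, Fintype.card_fin]
  refine Finset.sum_congr rfl fun k _ => ?_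
  rw [nsmul_eq_mul]
  ring

lemma meanLength_nonneg (ν : Measure Plane) (k : ℕ) : 0 ≤ meanLength p₀ p₁ p₂ ν k :=
  integral_nonneg fun x => familyLength_nonneg x

lemma meanLength_le (h : p₀ ≠ p₂) (ν : Measure Plane) [IsProbabilityMeasure ν] (k : ℕ) :
    meanLength p₀ p₁ p₂ ν k ≤ k := by
  have := integral_mono (integrable_familyLength (p₁ := p₁) h (Measure.pi fun _ : Fin k => ν))
    (integrable_const (k : ℝ)) (fun x => by simpa using familyLength_le_card h x)
  simpa [meanLength] using this

lemma meanLength_monotone (h : p₀ ≠ p₂) (ν : Measure Plane) [IsProbabilityMeasure ν] :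
    Monotone (meanLength p₀ p₁ p₂ ν) := by
  refine monotone_nat_of_le_succ fun k => ?_
  have hmp := measurePreserving_snd.comp
    (measurePreserving_piFinSuccAbove (fun _ : Fin (k + 1) => ν) 0)
  have h1 := integral_map hmp.measurable.aemeasurable
    (measurable_familyLength (p₁ := p₁) h).aestronglyMeasurable (μ := Measure.pi fun _ : Fin (k + 1) => ν)
  rw [hmp.map_eq] at h1
  have hint := integrable_familyLength (p₁ := p₁) h (Measure.pi fun _ : Fin k => ν)
  refine h1.le.trans (integral_mono (hmp.integrable_comp_of_integrable hint)
    (integrable_familyLength h _) fun x => ?_)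
  exact familyLength_comp_le h x (Fin.succEmb k)

/-- Affine invariance of the expected length. -/
lemma meanLength_uniformTriangle (hd : triangleDet p₀ p₁ p₂ ≠ 0) (k : ℕ) :
    meanLength p₀ p₁ p₂ (uniformTriangle p₀ p₁ p₂) k
      = meanLength std₀ std₁ std₂ (uniformTriangle std₀ std₁ std₂) k := by
  have := isProbabilityMeasure_uniformTriangle hd
  have hmp := measurePreserving_pi (fun _ : Fin k => uniformTriangle std₀ std₁ std₂)
    (fun _ : Fin k => uniformTriangle p₀ p₁ p₂) (fun _ => measurePreserving_triangleMap hd)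
  have hs : std₀ ≠ std₂ := fun e => by
    have := congrArg (fun z : Plane => z 0) e
    simp [std₀, std₂] at this
  have hp : p₀ ≠ p₂ := fun e => hs (triangleMap_injective hd (by
    rw [triangleMap_std₀, triangleMap_std₂, e]))
  unfold meanLength
  rw [← hmp.map_eq, integral_map hmp.measurable.aemeasurable
    (measurable_familyLength hp).aestronglyMeasurable]
  congr 1
  ext1 x
  refine le_antisymm (familyLength_le_of_forall hp hs fun k f hf => ⟨f, ?_⟩)
    (familyLength_le_of_forall hs hp fun k f hf => ⟨f, ?_⟩)
  · exact (isChainFamily_triangleMap_iff hd).1 hf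
  · exact (isChainFamily_triangleMap_iff hd).2 hf

end

/-! ### The expected length in the standard triangle -/

/-- The expected length `E L_k` for the standard triangle. -/
noncomputable def stdMean : ℕ → ℝ :=
  meanLength std₀ std₁ std₂ (uniformTriangle std₀ std₁ std₂)

lemma std₀_ne_std₂ : std₀ ≠ std₂ := fun e => by
  have := congrArg (fun z : Plane => z 0) e
  simp [std₀, std₂] at this

/-- A point off the side `p₀ p₂` is a chain of length one, and almost every point is off it. -/
lemma one_le_stdMean_one : 1 ≤ stdMean 1 := by
  set μ := uniformTriangle std₀ std₁ std₂ with hμ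
  have hline : volume {z : Plane | z 0 = z 1} = 0 := by
    let L : Submodule ℝ Plane := LinearMap.ker
      ((EuclideanSpace.proj (0 : Fin 2) : Plane →L[ℝ] ℝ) - EuclideanSpace.proj 1).toLinearMap
    have hL : L ≠ ⊤ := by
      intro e
      have : std₁ ∈ L := e ▸ Submodule.mem_top
      simp [L, std₁] at this
    have e : {z : Plane | z 0 = z 1} = L := by
      ext z
      simp [L, sub_eq_zero]
    rw [e]
    exact Measure.addHaar_submodule _ _ hL
  have hae : ∀ᵐ z ∂μ, z ∈ triangle std₀ std₁ std₂ ∧ z 0 ≠ z 1 := by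
    refine (ae_cond_mem isClosed_triangle.measurableSet).and ?_
    exact cond_absolutelyContinuous (measure_eq_zero_iff_ae_notMem.1 hline)
  have hae' : ∀ᵐ x ∂Measure.pi (fun _ : Fin 1 => μ),
      x 0 ∈ triangle std₀ std₁ std₂ ∧ x 0 0 ≠ x 0 1 :=
    (measurePreserving_eval (fun _ : Fin 1 => μ) 0).quasiMeasurePreserving.ae hae
  have : ∫ x : Fin 1 → Plane, (1 : ℝ) ∂Measure.pi (fun _ : Fin 1 => μ) ≤ stdMean 1 := by
    refine integral_mono_ae (integrable_const _) (integrable_familyLength std₀_ne_std₂ _) ?_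
    filter_upwards [hae'] with x hx
    rw [← Nat.cast_one, natCast_le_familyLength_iff std₀_ne_std₂]
    refine ⟨Function.Embedding.refl _, fun i => ?_, ?_⟩
    · rw [Subsingleton.elim i 0]
      exact hx.1
    obtain ⟨⟨h1, h2, h3⟩, h4⟩ := And.imp_left mem_triangle_std.1 hx
    have h5 : x 0 1 < x 0 0 := lt_of_le_of_ne h2 (Ne.symm h4)
    refine convexIndependent_iff_exists_functional.2 ?_
    rintro (i | i)
    · refine ⟨EuclideanSpace.proj 0 - EuclideanSpace.proj 1, ?_⟩
      rw [Subsingleton.elim i 0]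
      rintro (j | j) hj
      · exact absurd (by rw [Subsingleton.elim j 0]) hj
      · fin_cases j <;> simpa [std₀, std₂] using h5
    · fin_cases i
      · refine ⟨-EuclideanSpace.proj 0, ?_⟩
        rintro (j | j) hj
        · rw [Subsingleton.elim j 0]
          simp [std₀]
          linarith
        · fin_cases j
          · exact absurd rfl hj
          · simp [std₀, std₂]
      · refine ⟨EuclideanSpace.proj 1, ?_⟩
        rintro (j | j) hj
        · rw [Subsingleton.elim j 0]
          simp [std₂]
          linarith
        · fin_cases j
          · simp [std₀, std₂]
          · exact absurd rfl hj
  simpa using this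

/-- Superadditivity of the expected length: cut off from the standard triangle two triangles of
relative areas `t ^ 3` and `(1 - t) ^ 3` and concatenate their longest chains. -/
lemma stdMean_superadditive (n : ℕ) (t : ℝ) (ht0 : 0 < t) (ht1 : t < 1) :
    binomMean stdMean n (t ^ 3) + binomMean stdMean n ((1 - t) ^ 3) ≤ stdMean n := by
  have h1t : 0 < 1 - t := by linarith
  set μ := uniformTriangle std₀ std₁ std₂ with hμ
  set q₀ : Plane := (1 - t) • std₀ + t • std₁ with hq₀
  set q₁ : Plane := (1 - t) • std₁ + t • std₂ with hq₁
  set r : Plane := (1 - t) • q₀ + t • q₁ with hr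
  have hd1 : triangleDet std₀ q₀ r = t ^ 3 := by
    simp [triangleDet, hr, hq₀, hq₁, std₀, std₁, std₂]; ring
  have hd2 : triangleDet r q₁ std₂ = (1 - t) ^ 3 := by
    simp [triangleDet, hr, hq₀, hq₁, std₀, std₁, std₂]; ring
  have hn1 : std₀ ≠ r := fun e => by
    have := congrArg (fun z : Plane => z 1) e
    simp [hr, hq₀, hq₁, std₀, std₁, std₂] at this
    exact ht0.ne' this
  have hn2 : r ≠ std₂ := fun e => by
    have := congrArg (fun z : Plane => z 1) e
    simp [hr, hq₀, hq₁, std₀, std₁, std₂] at this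
    nlinarith
  have hmem : ∀ a b c : Plane, a ∈ triangle std₀ std₁ std₂ → b ∈ triangle std₀ std₁ std₂ →
      c ∈ triangle std₀ std₁ std₂ → triangle a b c ⊆ triangle std₀ std₁ std₂ := by
    intro a b c ha hb hc
    exact convexHull_min (by rintro z (rfl | rfl | rfl) <;> assumption) (convex_convexHull ℝ _)
  have hc := convex_convexHull ℝ {std₀, std₁, std₂}
  have m0 : std₀ ∈ triangle std₀ std₁ std₂ := subset_convexHull ℝ _ (by simp)
  have m1 : std₁ ∈ triangle std₀ std₁ std₂ := subset_convexHull ℝ _ (by simp)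
  have m2 : std₂ ∈ triangle std₀ std₁ std₂ := subset_convexHull ℝ _ (by simp)
  have mq0 : q₀ ∈ triangle std₀ std₁ std₂ := hc m0 m1 h1t.le ht0.le (by ring)
  have mq1 : q₁ ∈ triangle std₀ std₁ std₂ := hc m1 m2 h1t.le ht0.le (by ring)
  have mr : r ∈ triangle std₀ std₁ std₂ := hc mq0 mq1 h1t.le ht0.le (by ring)
  have key : ∀ a b c : Plane, triangle a b c ⊆ triangle std₀ std₁ std₂ → a ≠ c →
      0 < triangleDet a b c →
      meanLength a b c μ n = binomMean stdMean n (triangleDet a b c) := by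
    intro a b c hsub hac hpos
    have hreal : μ.real (triangle a b c) = triangleDet a b c := by
      rw [hμ, uniformTriangle, Measure.real, cond_apply isClosed_triangle.measurableSet,
        Set.inter_eq_self_of_subset_right hsub, ENNReal.toReal_mul, ENNReal.toReal_inv,
        volume_triangle hpos.ne', ENNReal.toReal_mul, ENNReal.toReal_ofReal (abs_nonneg _),
        abs_of_pos hpos]
      have : (volume (triangle std₀ std₁ std₂)).toReal ≠ 0 :=
        (ENNReal.toReal_pos volume_std_ne_zero volume_triangle_ne_top).ne'
      field_simp
    have hcond : ProbabilityTheory.cond μ (triangle a b c) = uniformTriangle a b c := by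
      rw [hμ, uniformTriangle, cond_cond_eq_cond_inter' isClosed_triangle.measurableSet
        isClosed_triangle.measurableSet volume_triangle_ne_top,
        Set.inter_eq_self_of_subset_right hsub, uniformTriangle]
    rw [meanLength_eq_binomMean hac, hreal, hcond]
    congr 1
    ext1 k
    exact meanLength_uniformTriangle hpos.ne' k
  rw [← hd1, ← hd2, ← key _ _ _ (hmem _ _ _ m0 mq0 mr) hn1 (by rw [hd1]; positivity),
    ← key _ _ _ (hmem _ _ _ mr mq1 m2) hn2 (by rw [hd2]; positivity)]
  unfold stdMean meanLength
  rw [← integral_add (integrable_familyLength hn1 _) (integrable_familyLength hn2 _)]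
  refine integral_mono ((integrable_familyLength hn1 _).add (integrable_familyLength hn2 _))
    (integrable_familyLength std₀_ne_std₂ _) fun x => ?_
  classical
  have := longestChain_add_le (p₀ := std₀) (p₁ := std₁) (p₂ := std₂) ht0 ht1 hq₀ hq₁ hr
    ⟨-EuclideanSpace.proj 0, by simp [std₀, std₁], by simp [std₀, std₂]⟩
    ⟨EuclideanSpace.proj 1, by simp [std₀, std₂], by simp [std₁, std₂]⟩ hn1 hn2 x
  simp only [familyLength]
  exact_mod_cast this

/-! ### The volume of the set of ordered chains -/

/-- If `A` has pairwise disjoint images in `B` under a finite family of measure preserving maps,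
its measure is at most that of `B` divided by the number of maps. -/
lemma card_mul_measure_le {α ι : Type*} [MeasurableSpace α] [Fintype ι] {μ : Measure α}
    {T : ι → α → α} (hT : ∀ i, MeasurePreserving (T i) μ μ) {A B : Set α} (hA : MeasurableSet A)
    (hsub : ∀ i, T i ⁻¹' A ⊆ B) (hinj : ∀ i j w, T i w ∈ A → T j w ∈ A → i = j) :
    (Fintype.card ι : ENNReal) * μ A ≤ μ B := by
  have hd : Pairwise (Function.onFun Disjoint fun i => T i ⁻¹' A) := by
    intro i j hij
    exact Set.disjoint_left.2 fun w hi hj => hij (hinj i j w hi hj)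
  calc (Fintype.card ι : ENNReal) * μ A = ∑ i, μ (T i ⁻¹' A) := by
        simp [(hT _).measure_preimage hA.nullMeasurableSet]
    _ = μ (⋃ i, T i ⁻¹' A) := by
        rw [measure_iUnion hd fun i => (hT i).measurable hA, tsum_fintype]
    _ ≤ μ B := measure_mono (Set.iUnion_subset hsub)

lemma volume_preserving_comp_perm {k : ℕ} (σ : Equiv.Perm (Fin k)) :
    MeasurePreserving (fun x : Fin k → ℝ => x ∘ σ) := by
  have := volume_measurePreserving_piCongrLeft (fun _ : Fin k => ℝ) σ.symm
  have e : (fun x : Fin k → ℝ => x ∘ σ) = MeasurableEquiv.piCongrLeft (fun _ => ℝ) σ.symm := by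
    funext x i
    have := MeasurableEquiv.piCongrLeft_apply_apply (β := fun _ : Fin k => ℝ) σ.symm x (σ i)
    rw [Equiv.symm_apply_apply] at this
    exact this.symm
  rw [e]
  exact this

/-- A family of reals can be sorted increasingly in only one way. -/
lemma perm_eq_of_strictMono_comp {k : ℕ} {s : Fin k → ℝ} {σ τ : Equiv.Perm (Fin k)}
    (hσ : StrictMono (s ∘ σ)) (hτ : StrictMono (s ∘ τ)) : σ = τ := by
  have hr : Set.range (s ∘ σ) = Set.range (s ∘ τ) := by
    rw [σ.surjective.range_comp, τ.surjective.range_comp]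
  have he := (hσ.range_inj hτ).1 hr
  have hs : Function.Injective s := by
    have := hσ.injective.comp σ.symm.injective
    rwa [Function.comp_assoc, Equiv.self_comp_symm, Function.comp_id] at this
  ext i
  exact congrArg Fin.val (hs (congrFun he i))

lemma measurableSet_strictMono {α : Type*} [MeasurableSpace α] {k : ℕ} {f : α → Fin k → ℝ}
    (hf : Measurable f) : MeasurableSet {x | StrictMono (f x)} := by
  have hf' : ∀ i, Measurable fun x => f x i := fun i => (measurable_pi_apply i).comp hf
  unfold StrictMono
  simp only [Set.ofPred_forall]
  exact MeasurableSet.iInter fun i => MeasurableSet.iInter fun j => MeasurableSet.iInter fun _ =>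
    measurableSet_lt (hf' i) (hf' j)

lemma factorial_mul_volume_strictMono_le (k : ℕ) :
    (k.factorial : ENNReal) * volume {x : Fin k → ℝ | StrictMono x ∧ x ∈ Set.Icc 0 1} ≤ 1 := by
  have := card_mul_measure_le (μ := (volume : Measure (Fin k → ℝ)))
    (T := fun (σ : Equiv.Perm (Fin k)) x => x ∘ σ) (B := Set.Icc 0 1)
    (A := {x : Fin k → ℝ | StrictMono x ∧ x ∈ Set.Icc 0 1}) volume_preserving_comp_perm
    ((measurableSet_strictMono measurable_id).inter measurableSet_Icc) ?_ ?_
  · rw [Fintype.card_perm, Fintype.card_fin, Real.volume_Icc_pi] at this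
    simpa using this
  · rintro σ x ⟨-, h0, h1⟩
    refine ⟨fun i => ?_, fun i => ?_⟩
    · have : 0 ≤ x (σ (σ.symm i)) := h0 (σ.symm i)
      rwa [Equiv.apply_symm_apply] at this
    · have : x (σ (σ.symm i)) ≤ 1 := h1 (σ.symm i)
      rwa [Equiv.apply_symm_apply] at this
  · rintro σ τ x ⟨h1, -⟩ ⟨h2, -⟩
    exact perm_eq_of_strictMono_comp h1 h2

/-- The linear map that sends a sequence of increments to the sequence of its partial sums. -/
def cumsum (k : ℕ) : (Fin k → ℝ) →ₗ[ℝ] (Fin k → ℝ) :=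
  Matrix.toLin' (Matrix.of fun i j => if j ≤ i then 1 else 0)

lemma cumsum_apply {k : ℕ} (a : Fin k → ℝ) (i : Fin k) :
    cumsum k a i = ∑ j ∈ Finset.univ.filter (· ≤ i), a j := by
  simp [cumsum, Matrix.mulVec, dotProduct, Finset.sum_filter]

lemma cumsum_eq_of_val_eq_zero {k : ℕ} (a : Fin k → ℝ) {i : Fin k} (hi : i.val = 0) :
    cumsum k a i = a i := by
  have e : Finset.univ.filter (· ≤ i) = {i} := by
    ext j
    simp [Fin.le_def, Fin.ext_iff, hi]
  rw [cumsum_apply, e, Finset.sum_singleton]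

lemma cumsum_eq_add {k : ℕ} (a : Fin k → ℝ) {i j : Fin k} (hij : j.val = i.val + 1) :
    cumsum k a j = cumsum k a i + a j := by
  have e : Finset.univ.filter (· ≤ j) = insert j (Finset.univ.filter (· ≤ i)) := by
    ext l
    simp only [Finset.mem_filter, Finset.mem_univ, true_and, Finset.mem_insert, Fin.le_def,
      Fin.ext_iff]
    lia
  have hj : j ∉ Finset.univ.filter (· ≤ i) := by
    simp [Fin.lt_def, hij]
  rw [cumsum_apply, cumsum_apply, e, Finset.sum_insert hj, add_comm]

lemma cumsum_le_sum {k : ℕ} {a : Fin k → ℝ} (ha : ∀ i, 0 ≤ a i) (i : Fin k) :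
    cumsum k a i ≤ ∑ j, a j := by
  rw [cumsum_apply]
  exact Finset.sum_le_sum_of_subset_of_nonneg (Finset.filter_subset _ _) fun j _ _ => ha j

lemma cumsum_last {m : ℕ} (a : Fin (m + 1) → ℝ) : cumsum (m + 1) a (Fin.last m) = ∑ j, a j := by
  rw [cumsum_apply]
  congr 1
  ext j
  simp [Fin.le_last]

lemma volume_preserving_cumsum (k : ℕ) : MeasurePreserving (cumsum k) := by
  have hdet : Matrix.det (Matrix.of fun i j : Fin k => if j ≤ i then (1 : ℝ) else 0) = 1 := by
    rw [Matrix.det_of_isLowerTriangular]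
    · simp
    · intro i j hij
      have : i < j := hij
      simp [this]
  refine ⟨(LinearMap.continuous_of_finiteDimensional _).measurable, ?_⟩
  have := Real.map_matrix_volume_pi_eq_smul_volume_pi
    (M := Matrix.of fun i j : Fin k => if j ≤ i then (1 : ℝ) else 0) (by rw [hdet]; norm_num)
  rw [hdet] at this
  simpa [cumsum] using this

/-- The positive sequences with sum at most `1` form a simplex of volume `1 / k!`. -/
lemma factorial_mul_volume_simplex_le (k : ℕ) :
    (k.factorial : ENNReal) * volume {a : Fin k → ℝ | (∀ i, 0 < a i) ∧ ∑ i, a i ≤ 1} ≤ 1 := by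
  refine le_trans ?_ (factorial_mul_volume_strictMono_le k)
  have hm : MeasurableSet {x : Fin k → ℝ | StrictMono x ∧ x ∈ Set.Icc 0 1} :=
    (measurableSet_strictMono measurable_id).inter measurableSet_Icc
  rw [← (volume_preserving_cumsum k).measure_preimage hm.nullMeasurableSet]
  gcongr
  rintro a ⟨ha, hs⟩
  refine ⟨fun i j hij => ?_, fun i => ?_, fun i => ?_⟩
  · rw [cumsum_apply, cumsum_apply]
    refine Finset.sum_lt_sum_of_subset (i := j) (fun l hl => ?_) (by simp) (by simpa using hij)
      (ha j) fun l _ _ => (ha l).le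
    simp only [Finset.mem_filter, Finset.mem_univ, true_and] at hl ⊢
    exact hl.trans hij.le
  · rw [cumsum_apply]
    exact Finset.sum_nonneg fun j _ => (ha j).le
  · exact (cumsum_le_sum (fun j => (ha j).le) i).trans hs

/-- The increments `(a, b)` of the coordinates along a chain: positive, with sums at most `1`, and
with increasing slopes `b i / a i`. -/
def sortedIncrements (k : ℕ) : Set ((Fin k → ℝ) × (Fin k → ℝ)) :=
  {w | ((∀ i, 0 < w.1 i) ∧ ∑ i, w.1 i ≤ 1) ∧ ((∀ i, 0 < w.2 i) ∧ ∑ i, w.2 i ≤ 1) ∧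
    StrictMono fun i => w.2 i / w.1 i}

lemma measurableSet_sortedIncrements (k : ℕ) : MeasurableSet (sortedIncrements k) := by
  have h : ∀ f : (Fin k → ℝ) × (Fin k → ℝ) → Fin k → ℝ, Measurable f →
      MeasurableSet {w | (∀ i, 0 < f w i) ∧ ∑ i, f w i ≤ 1} := by
    intro f hf
    have hf' : ∀ i, Measurable fun x => f x i := fun i => (measurable_pi_apply i).comp hf
    refine MeasurableSet.inter (s₁ := {w | ∀ i, 0 < f w i}) ?_
      (measurableSet_le (Finset.measurable_sum _ fun i _ => hf' i) measurable_const)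
    rw [Set.ofPred_forall]
    exact MeasurableSet.iInter fun i => measurableSet_lt measurable_const (hf' i)
  refine (h _ measurable_fst).inter ((h _ measurable_snd).inter (measurableSet_strictMono ?_))
  exact measurable_pi_lambda _ fun i => by fun_prop

/-- The `k!` permutations of the increments have disjoint images in a product of two simplices. -/
lemma factorial_pow_mul_volume_sortedIncrements_le (k : ℕ) :
    (k.factorial : ENNReal) ^ 3 * volume (sortedIncrements k) ≤ 1 := by
  set D : Set (Fin k → ℝ) := {a | (∀ i, 0 < a i) ∧ ∑ i, a i ≤ 1} with hD
  have h := card_mul_measure_le (μ := (volume : Measure ((Fin k → ℝ) × (Fin k → ℝ))))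
    (T := fun (σ : Equiv.Perm (Fin k)) => Prod.map (fun x => x ∘ σ) (fun x => x ∘ σ))
    (A := sortedIncrements k) (B := D ×ˢ D)
    (fun σ => (volume_preserving_comp_perm σ).prod (volume_preserving_comp_perm σ))
    (measurableSet_sortedIncrements k) ?_ ?_
  · rw [Fintype.card_perm, Fintype.card_fin, Measure.volume_eq_prod, Measure.prod_prod] at h
    have h2 := factorial_mul_volume_simplex_le k
    calc (k.factorial : ENNReal) ^ 3 * volume (sortedIncrements k)
        = (k.factorial : ENNReal) ^ 2 * (k.factorial * volume (sortedIncrements k)) := by ring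
      _ ≤ (k.factorial : ENNReal) ^ 2 * (volume D * volume D) := mul_le_mul' le_rfl h
      _ = (k.factorial * volume D) * (k.factorial * volume D) := by ring
      _ ≤ 1 * 1 := by gcongr
      _ = 1 := one_mul 1
  · have hperm : ∀ (σ : Equiv.Perm (Fin k)) (a : Fin k → ℝ), a ∘ σ ∈ D → a ∈ D := by
      rintro σ a ⟨h1, h2⟩
      refine ⟨fun i => ?_, ?_⟩
      · have := h1 (σ.symm i)
        rwa [Function.comp_apply, Equiv.apply_symm_apply] at this
      · rwa [← Equiv.sum_comp σ]
    rintro σ w ⟨h1, h2, -⟩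
    exact ⟨hperm σ _ h1, hperm σ _ h2⟩
  · rintro σ τ w ⟨-, -, h1⟩ ⟨-, -, h2⟩
    exact perm_eq_of_strictMono_comp (s := fun i => w.2 i / w.1 i) h1 h2

/-- The sequences of first and second coordinates of the points of a chain in the standard
triangle, listed from left to right; the slopes, starting from the origin, increase. -/
def orderedChains (k : ℕ) : Set ((Fin k → ℝ) × (Fin k → ℝ)) :=
  {w | (∀ i, 0 < w.1 i) ∧ (∀ i, w.1 i ≤ 1) ∧ (∀ i, 0 ≤ w.2 i) ∧ (∀ i, w.2 i ≤ 1) ∧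
    StrictMono w.1 ∧ StrictMono w.2 ∧
    (∀ j l, j < l → w.2 j * (w.1 l - w.1 j) < (w.2 l - w.2 j) * w.1 j) ∧
    ∀ i j l, i < j → j < l →
      (w.2 j - w.2 i) * (w.1 l - w.1 j) < (w.2 l - w.2 j) * (w.1 j - w.1 i)}

lemma measurableSet_orderedChains (k : ℕ) : MeasurableSet (orderedChains k) := by
  have h1 : ∀ i, Measurable fun w : (Fin k → ℝ) × (Fin k → ℝ) => w.1 i := fun i => by fun_prop
  have h2 : ∀ i, Measurable fun w : (Fin k → ℝ) × (Fin k → ℝ) => w.2 i := fun i => by fun_prop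
  unfold orderedChains
  simp only [Set.ofPred_and, Set.ofPred_forall]
  refine .inter (.iInter fun i => measurableSet_lt measurable_const (h1 i)) <|
    .inter (.iInter fun i => measurableSet_le (h1 i) measurable_const) <|
    .inter (.iInter fun i => measurableSet_le measurable_const (h2 i)) <|
    .inter (.iInter fun i => measurableSet_le (h2 i) measurable_const) <|
    .inter (measurableSet_strictMono measurable_fst) <|
    .inter (measurableSet_strictMono measurable_snd) <|
    .inter (.iInter fun j => .iInter fun l => .iInter fun _ => measurableSet_lt ?_ ?_) <|
    (.iInter fun i => .iInter fun j => .iInter fun l => .iInter fun _ => .iInter fun _ =>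
      measurableSet_lt ?_ ?_)
  all_goals fun_prop

lemma factorial_pow_mul_volume_orderedChains_le (m : ℕ) :
    ((m + 1).factorial : ENNReal) ^ 3 * volume (orderedChains (m + 1)) ≤ 1 := by
  refine le_trans ?_ (factorial_pow_mul_volume_sortedIncrements_le (m + 1))
  refine mul_le_mul' le_rfl ?_
  have hC := (volume_preserving_cumsum (m + 1)).prod (volume_preserving_cumsum (m + 1))
  -- the first vertical increment may vanish, but only on a null set
  have hnull : volume {w : (Fin (m + 1) → ℝ) × (Fin (m + 1) → ℝ) | w.2 0 = 0} = 0 := by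
    have e : {w : (Fin (m + 1) → ℝ) × (Fin (m + 1) → ℝ) | w.2 0 = 0}
        = Set.univ ×ˢ {b : Fin (m + 1) → ℝ | b 0 = 0} := by
      ext w
      simp
    rw [e, Measure.volume_eq_prod, Measure.prod_prod, volume_pi, Measure.pi_hyperplane, mul_zero]
  rw [Measure.volume_eq_prod,
    ← hC.measure_preimage (measurableSet_orderedChains (m + 1)).nullMeasurableSet,
    ← Measure.volume_eq_prod]
  refine (measure_mono ?_).trans ((measure_union_le (sortedIncrements (m + 1)) _).trans
    (by rw [hnull, add_zero]))
  rintro ⟨a, b⟩ ⟨x0, x1, y0, y1, hx, hy, hs0, hs⟩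
  simp only [Prod.map_fst, Prod.map_snd] at x0 x1 y0 y1 hx hy hs0 hs
  by_cases hb0 : b 0 = 0
  · exact Or.inr hb0
  left
  -- each index is the first one or has a predecessor
  have hcase : ∀ i : Fin (m + 1), i.val = 0 ∨ ∃ j : Fin (m + 1), i.val = j.val + 1 := by
    intro i
    rcases Nat.eq_zero_or_pos i.val with h | h
    · exact Or.inl h
    · exact Or.inr ⟨⟨i.val - 1, by lia⟩, by simp; lia⟩
  have hlt : ∀ {i j : Fin (m + 1)}, i.val = j.val + 1 → j < i := fun {i j} h => by
    rw [Fin.lt_def]; lia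
  have ha : ∀ i, 0 < a i := by
    intro i
    rcases hcase i with h | ⟨j, h⟩
    · rw [← cumsum_eq_of_val_eq_zero a h]
      exact x0 i
    · have := hx (hlt h)
      rw [cumsum_eq_add a h] at this
      linarith
  have hb : ∀ i, 0 < b i := by
    intro i
    rcases hcase i with h | ⟨j, h⟩
    · refine lt_of_le_of_ne ?_ (Ne.symm ?_)
      · rw [← cumsum_eq_of_val_eq_zero b h]
        exact y0 i
      · rwa [show i = 0 from Fin.ext h]
    · have := hy (hlt h)
      rw [cumsum_eq_add b h] at this
      linarith
  refine ⟨⟨ha, ?_⟩, ⟨hb, ?_⟩, Fin.strictMono_iff_lt_succ.2 fun i => ?_⟩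
  · rw [← cumsum_last]
    exact x1 _
  · rw [← cumsum_last]
    exact y1 _
  · have hsucc : i.succ.val = i.castSucc.val + 1 := by simp
    change b i.castSucc / a i.castSucc < b i.succ / a i.succ
    rw [div_lt_div_iff₀ (ha _) (ha _)]
    rcases hcase i.castSucc with h | ⟨j, h⟩
    · have := hs0 _ _ (hlt hsucc)
      rw [cumsum_eq_add a hsucc, cumsum_eq_add b hsucc, cumsum_eq_of_val_eq_zero a h,
        cumsum_eq_of_val_eq_zero b h] at this
      linarith
    · have := hs _ _ _ (hlt h) (hlt hsucc)
      rw [cumsum_eq_add a hsucc, cumsum_eq_add b hsucc, cumsum_eq_add a h,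
        cumsum_eq_add b h] at this
      linarith

/-! ### The first moment bound -/

/-- A functional that exposes a point of a chain in the standard triangle increases with the first
coordinate and decreases with the second. -/
lemma IsChainFamily.exists_pos_functional {k : ℕ} {x : Fin k → Plane}
    (hx : IsChainFamily std₀ std₁ std₂ x) (i : Fin k) :
    ∃ u v : ℝ, 0 < u ∧ 0 < v ∧ 0 < u * x i 0 - v * x i 1 ∧
      ∀ j, j ≠ i → u * x j 0 - v * x j 1 < u * x i 0 - v * x i 1 := by
  obtain ⟨ℓ, hℓ⟩ := convexIndependent_iff_exists_functional.1 hx.2 (Sum.inl i)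
  have hdec : ∀ z : Plane, ℓ z = ℓ std₁ * z 0 - (ℓ std₁ - ℓ std₂) * z 1 := by
    intro z
    have e : z = z 0 • std₁ + z 1 • (std₂ - std₁) := by
      ext i
      fin_cases i <;> simp [std₁, std₂]
    rw [e, map_add, map_smul, map_smul, map_sub]
    simp [std₁, std₂]
    ring
  set u := ℓ std₁
  set v := u - ℓ std₂ with hv
  have h0 : ℓ std₀ < ℓ (x i) := by simpa using hℓ (Sum.inr 0) (by simp)
  have h2 : ℓ std₂ < ℓ (x i) := by simpa using hℓ (Sum.inr 1) (by simp)
  have e0 : ℓ std₀ = 0 := by rw [hdec]; simp [std₀]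
  have e2 : ℓ std₂ = u - v := by rw [hv]; ring
  rw [e0, hdec] at h0
  rw [e2, hdec] at h2
  obtain ⟨t1, t2, t3⟩ := mem_triangle_std.1 (hx.1 i)
  refine ⟨u, v, ?_, ?_, h0, fun j hj => ?_⟩
  · by_contra! hu
    rcases le_total (u - v) 0 with h | h <;> nlinarith
  · by_contra! hv
    rcases le_total (u - v) 0 with h | h <;> nlinarith
  · have := hℓ (Sum.inl j) (fun e => hj (Sum.inl_injective e))
    rw [Sum.elim_inl, Sum.elim_inl, hdec, hdec (x i)] at this
    exact this

/-- The points of a chain, listed from left to right, form an ordered chain. -/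
lemma IsChainFamily.exists_perm_mem_orderedChains {k : ℕ} {x : Fin k → Plane}
    (hx : IsChainFamily std₀ std₁ std₂ x) :
    ∃ σ : Equiv.Perm (Fin k),
      ((fun i => x (σ i) 0, fun i => x (σ i) 1) : (Fin k → ℝ) × (Fin k → ℝ)) ∈ orderedChains k := by
  have hT : ∀ i, 0 ≤ x i 1 ∧ x i 1 ≤ x i 0 ∧ x i 0 ≤ 1 := fun i => mem_triangle_std.1 (hx.1 i)
  choose u v hu hv h0 hlt using hx.exists_pos_functional
  have hinj : Function.Injective fun i => x i 0 := by
    intro i j hij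
    by_contra hne
    have h1 := hlt i j (Ne.symm hne)
    have h2 := hlt j i hne
    simp only at hij
    rw [hij] at h1 h2
    have h3 : x i 1 < x j 1 := lt_of_mul_lt_mul_left (by linarith) (hv i).le
    have h4 : x j 1 < x i 1 := lt_of_mul_lt_mul_left (by linarith) (hv j).le
    exact lt_asymm h3 h4
  have hy : ∀ i j, x i 0 < x j 0 → x i 1 < x j 1 := by
    intro i j hij
    have h1 := hlt i j (fun e => by rw [e] at hij; exact lt_irrefl _ hij)
    have h2 := mul_lt_mul_of_pos_left hij (hu i)
    exact lt_of_mul_lt_mul_left (by linarith) (hv i).le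
  let σ := Tuple.sort fun i => x i 0
  have hσ : StrictMono ((fun i => x i 0) ∘ σ) :=
    (Tuple.monotone_sort _).strictMono_of_injective (hinj.comp σ.injective)
  have hne : ∀ {i j : Fin k}, x i 0 < x j 0 → i ≠ j := fun h e => by
    rw [e] at h; exact lt_irrefl _ h
  refine ⟨σ, fun i => ?_, fun i => (hT _).2.2, fun i => (hT _).1,
    fun i => (hT _).2.1.trans (hT _).2.2, hσ, fun i j hij => hy _ _ (hσ hij),
    fun j l hjl => ?_, fun i j l hij hjl => ?_⟩
  · have := h0 (σ i)
    have := mul_nonneg (hv (σ i)).le (hT (σ i)).1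
    exact pos_of_mul_pos_right (show 0 < u (σ i) * x (σ i) 0 by linarith) (hu _).le
  · have hjl' := hσ hjl
    simp only [Function.comp] at hjl' ⊢
    have a1 := h0 (σ j)
    have a2 := hlt (σ j) (σ l) (hne hjl').symm
    have a3 : 0 < x (σ j) 0 := by
      have := mul_nonneg (hv (σ j)).le (hT (σ j)).1
      exact pos_of_mul_pos_right (show 0 < u (σ j) * x (σ j) 0 by linarith) (hu _).le
    have b1 := mul_pos a1 (sub_pos.2 hjl')
    have b2 := mul_pos (sub_pos.2 a2) a3
    refine lt_of_mul_lt_mul_left ?_ (hv (σ j)).le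
    linarith
  · have hij' := hσ hij
    have hjl' := hσ hjl
    simp only [Function.comp] at hij' hjl' ⊢
    have a1 := hlt (σ j) (σ i) (hne hij')
    have a2 := hlt (σ j) (σ l) (hne hjl').symm
    have b1 := mul_pos (sub_pos.2 a1) (sub_pos.2 hjl')
    have b2 := mul_pos (sub_pos.2 a2) (sub_pos.2 hij')
    refine lt_of_mul_lt_mul_left ?_ (hv (σ j)).le
    linarith

lemma measurePreserving_comp_embedding {ι κ α : Type*} [Fintype ι] [Fintype κ] [MeasurableSpace α]
    (μ : Measure α) [IsProbabilityMeasure μ] (f : κ ↪ ι) :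
    MeasurePreserving (fun x : ι → α => x ∘ f) (Measure.pi fun _ => μ) (Measure.pi fun _ => μ) := by
  have hm : Measurable fun x : ι → α => x ∘ f :=
    measurable_pi_lambda _ fun i => measurable_pi_apply _
  refine ⟨hm, (Measure.pi_eq fun s hs => ?_).symm⟩
  rw [Measure.map_apply hm (MeasurableSet.univ_pi hs)]
  have e : (fun x : ι → α => x ∘ f) ⁻¹' Set.univ.pi s
      = Set.univ.pi (Function.extend f s fun _ => Set.univ) := by
    ext x
    simp only [Set.mem_preimage, Set.mem_univ_pi, Function.comp_apply]
    refine ⟨fun h i => ?_, fun h j => ?_⟩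
    · by_cases hi : ∃ j, f j = i
      · obtain ⟨j, rfl⟩ := hi
        rw [f.injective.extend_apply]
        exact h j
      · rw [Function.extend_apply' _ _ _ hi]
        trivial
    · have := h (f j)
      rwa [f.injective.extend_apply] at this
  rw [e, Measure.pi_pi]
  symm
  refine Fintype.prod_of_injective f f.injective _ _ (fun i hi => ?_) fun j => ?_
  · rw [Function.extend_apply' _ _ _ hi, measure_univ]
  · rw [f.injective.extend_apply]

/-- The coordinates of a sample of points. -/
def coordinates (k : ℕ) (x : Fin k → Plane) : (Fin k → ℝ) × (Fin k → ℝ) :=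
  (fun i => x i 0, fun i => x i 1)

lemma volume_preserving_coordinates (k : ℕ) : MeasurePreserving (coordinates k) :=
  (volume_measurePreserving_arrowProdEquivProdArrow ℝ ℝ (Fin k)).comp <|
    (volume_preserving_pi fun _ : Fin k => volume_preserving_finTwoArrow ℝ).comp <|
      volume_preserving_pi fun _ : Fin k => PiLp.volume_preserving_ofLp (Fin 2)

lemma pi_uniform_orderedChains_le (m : ℕ) :
    Measure.pi (fun _ : Fin (m + 1) => uniformTriangle std₀ std₁ std₂)
      (coordinates (m + 1) ⁻¹' orderedChains (m + 1))
      ≤ 2 ^ (m + 1) / ((m + 1).factorial : ENNReal) ^ 3 := by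
  set T := triangle std₀ std₁ std₂ with hT
  have hfin : IsFiniteMeasure ((volume : Measure Plane).restrict T) :=
    ⟨by rw [Measure.restrict_apply_univ]; exact volume_triangle_ne_top.lt_top⟩
  have hinv : (volume T)⁻¹ ≤ 2 := by
    rw [ENNReal.inv_le_iff_le_mul (fun _ => volume_std_ne_zero) (fun h => absurd h volume_triangle_ne_top)]
    exact half_le_volume_std.trans_eq (mul_comm _ _)
  unfold uniformTriangle ProbabilityTheory.cond
  rw [pi_const_smul _ (ENNReal.inv_ne_top.2 volume_std_ne_zero), ← Measure.restrict_pi_pi,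
    Measure.smul_apply, Fintype.card_fin, smul_eq_mul]
  have hvol : volume (orderedChains (m + 1)) ≤ (((m + 1).factorial : ENNReal) ^ 3)⁻¹ := by
    rw [ENNReal.le_inv_iff_mul_le, mul_comm]
    exact factorial_pow_mul_volume_orderedChains_le m
  rw [div_eq_mul_inv]
  gcongr
  refine (Measure.restrict_apply_le _ _).trans ?_
  rw [← volume_pi, (volume_preserving_coordinates (m + 1)).measure_preimage
    (measurableSet_orderedChains (m + 1)).nullMeasurableSet]
  exact hvol

/-- A union bound over the ordered `k`-tuples of sample points. -/
lemma measure_le_familyLength_le (n m : ℕ) :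
    Measure.pi (fun _ : Fin n => uniformTriangle std₀ std₁ std₂)
      {x | ((m + 1 : ℕ) : ℝ) ≤ familyLength std₀ std₁ std₂ x}
      ≤ (2 * n) ^ (m + 1) / ((m + 1).factorial : ENNReal) ^ 3 := by
  set μ := uniformTriangle std₀ std₁ std₂
  set O := coordinates (m + 1) ⁻¹' orderedChains (m + 1) with hO
  have hOm : MeasurableSet O :=
    (volume_preserving_coordinates _).measurable (measurableSet_orderedChains _)
  have hsub : {x : Fin n → Plane | ((m + 1 : ℕ) : ℝ) ≤ familyLength std₀ std₁ std₂ x}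
      ⊆ ⋃ f : Fin (m + 1) ↪ Fin n, (fun x => x ∘ f) ⁻¹' O := by
    intro x hx
    obtain ⟨f, hf⟩ := (natCast_le_familyLength_iff std₀_ne_std₂ x _).1 hx
    obtain ⟨σ, hσ⟩ := hf.exists_perm_mem_orderedChains
    exact Set.mem_iUnion.2 ⟨σ.toEmbedding.trans f, hσ⟩
  calc _ ≤ ∑ f : Fin (m + 1) ↪ Fin n, Measure.pi (fun _ : Fin n => μ) ((fun x => x ∘ f) ⁻¹' O) :=
        (measure_mono hsub).trans (measure_iUnion_fintype_le _ _)
    _ = (n.descFactorial (m + 1) : ENNReal) * Measure.pi (fun _ => μ) O := by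
        simp [(measurePreserving_comp_embedding μ _).measure_preimage hOm.nullMeasurableSet,
          Fintype.card_embedding_eq]
    _ ≤ (n : ENNReal) ^ (m + 1) * (2 ^ (m + 1) / ((m + 1).factorial : ENNReal) ^ 3) := by
        gcongr
        · exact_mod_cast Nat.descFactorial_le_pow n (m + 1)
        · exact pi_uniform_orderedChains_le m
    _ = _ := by
        rw [mul_pow, mul_div_assoc', mul_comm]

lemma stdMean_le (n k : ℕ) :
    stdMean n ≤ k + n * ((2 * n : ℝ) ^ k / (k.factorial : ℝ) ^ 3) := by
  rcases k with _ | m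
  · simpa [stdMean] using meanLength_le std₀_ne_std₂ (p₁ := std₁) (uniformTriangle std₀ std₁ std₂) n
  set μ := uniformTriangle std₀ std₁ std₂ with hμ
  set P := Measure.pi (fun _ : Fin n => μ) with hP
  set A := {x : Fin n → Plane | ((m + 1 : ℕ) : ℝ) ≤ familyLength std₀ std₁ std₂ x} with hA
  have hAm : MeasurableSet A :=
    measurableSet_le measurable_const (measurable_familyLength std₀_ne_std₂)
  have hPA : P.real A ≤ (2 * n : ℝ) ^ (m + 1) / ((m + 1).factorial : ℝ) ^ 3 := by
    have h := ENNReal.toReal_mono ?_ (measure_le_familyLength_le n m)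
    · simpa [Measure.real, hP, hA, hμ] using h
    · exact ENNReal.div_ne_top (by finiteness) (by positivity)
  have hle : ∀ x : Fin n → Plane, familyLength std₀ std₁ std₂ x
      ≤ (m + 1 : ℕ) + A.indicator (fun _ => (n : ℝ)) x := by
    intro x
    by_cases hx : x ∈ A
    · rw [Set.indicator_of_mem hx]
      have := familyLength_le_card std₀_ne_std₂ (p₁ := std₁) x
      rw [Fintype.card_fin] at this
      have : (0 : ℝ) ≤ (m + 1 : ℕ) := Nat.cast_nonneg _
      linarith
    · rw [Set.indicator_of_notMem hx, add_zero]
      exact (not_le.1 hx).le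
  have hint : Integrable (A.indicator fun _ : Fin n → Plane => (n : ℝ)) P :=
    (integrable_const _).indicator hAm
  have := integral_mono (integrable_familyLength std₀_ne_std₂ P)
    ((integrable_const _).add hint) hle
  rw [integral_add' (integrable_const _) hint, integral_indicator_const _ hAm] at this
  simp only [integral_const, probReal_univ, smul_eq_mul, one_mul] at this
  refine this.trans ?_
  rw [mul_comm (P.real A)]
  gcongr

theorem theorem1 :
    ∃ α : ℝ, 0 < α ∧
      (1 - Real.exp (-2)) / (2 : ℝ) ^ (1 / 3 : ℝ) ≤ α ∧
      α ≤ (2 : ℝ) ^ (1 / 3 : ℝ) * Real.exp 1 ∧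
      ∀ p₀ p₁ p₂ : Plane, AffineIndependent ℝ ![p₀, p₁, p₂] →
        (∀ n : ℕ, Integrable (chainLength p₀ p₁ p₂ n) (sampleLaw p₀ p₁ p₂ n)) ∧
        Tendsto
          (fun n : ℕ =>
            (∫ x, chainLength p₀ p₁ p₂ n x ∂(sampleLaw p₀ p₁ p₂ n)) / (n : ℝ) ^ (1 / 3 : ℝ))
          atTop (𝓝 α) := by
  obtain ⟨α, h0, h1, h2, h3⟩ := exists_limit_of_binomial_superadditive (a := stdMean)
    (fun k => meanLength_nonneg _ k) (fun k => meanLength_le std₀_ne_std₂ _ k)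
    (meanLength_monotone std₀_ne_std₂ _) one_le_stdMean_one stdMean_superadditive stdMean_le
  refine ⟨α, h0, h1, h2, fun p₀ p₁ p₂ hp => ?_⟩
  have hd := triangleDet_ne_zero hp
  have := isProbabilityMeasure_uniformTriangle hd
  have hne : p₀ ≠ p₂ := fun e => by
    have := hp.injective (a₁ := 0) (a₂ := 2) e
    simp at this
  refine ⟨fun n => integrable_familyLength hne (Measure.pi fun _ : Fin n => _), ?_⟩
  have e : ∀ n : ℕ, ∫ x, chainLength p₀ p₁ p₂ n x ∂(sampleLaw p₀ p₁ p₂ n) = stdMean n :=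
    fun n => meanLength_uniformTriangle hd n
  simpa only [e] using h3
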